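/- **Conventions.** A *$*$-TRO* in a C*-algebra $A$ is a norm-closed selfadjoint subspace $X\subset A$ with $XX^*X\subset X$. A *commutative involutive ternary system* is a complex normed space $Z$ with an involution and a ternary product $[x,y,z]$ that is isometric, via a $*$-linear map $T$ with $T[x,y,z]=T(x)T(y)^*T(z)$, to a $*$-TRO in a commutative C*-algebra. A subset $\mathfrak c$ of a $*$-TRO $X$ is a *natural cone* if there is an injective $*$-linear map $T$ with $T(xy^*z)=T(x)T(y)^*T(z)$ from $X$ onto a $*$-TRO in some C*-algebra $B$ such that $\mathfrak c=\{x\in X: T(x)\ge 0 \text{ in } B\}$. It is an *ordered operator space cone* if $\mathfrak c=\{x\in X: T(x)\ge 0\}$ for some completely isometric $*$-linear map $T$ of $X$ into a C*-algebra. A *maximal natural cone* is one that is maximal, for inclusion, among the natural cones of $X$; a *maximal cone* is one that is maximal, for inclusion, among the ordered operator space cones of $X$. **Statement.** Let $Z\neq 0$ be a commutative involutive ternary system. Let $\Omega$ be the set of extreme points of the closed unit ball of the space of selfadjoint bounded functionals on $Z$ (those with $\varphi(z^*)=\overline{\varphi(z)}$), with the weak* topology, and let $$W=\{f\in C_0(\Omega):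 f(-\psi)=-f(\psi)\ \text{for all } \psi\in\Omega\}.$$ Then $\Omega$ is locally compact, and $z\mapsto(\psi\mapsto\psi(z))$ is an isometric $*$-linear isomorphism of $Z$ onto $W$ that preserves the ternary products. Call $U\subset\Omega$ *antisymmetric* if $U\cap(-U)=\emptyset$, and for such an open $U$ put $$\mathfrak c_U=\{f\in W: f\ge 0\text{ on }U,\ f=0\text{ on }\Omega\setminus(U\cup(-U))\}.$$ 1. If $U\subset\Omega$ is open and antisymmetric, the following are equivalent: - (i) $\mathfrak c_U$ is a maximal natural cone of $W$; - (ii) $\Omega\setminus(U\cup(-U))=\mathrm{Bdy}(U)$; - (iii) $\Omega\setminus(U\cup(-U))=\mathrm{Bdy}(-U)$; - (iv) $\mathrm{Bdy}(U)=\mathrm{Bdy}(-U)$ and $\Omega\setminus(U\cup(-U))$ has no interior points; - (v) there is no open antisymmetric set $U'\subset\Omega$ properly containing $U$. If these hold, then $\mathfrak c_U$ consists of all $f\in W$ which are nonnegative on $U$. 2. Every maximal cone of $W$ is of the form $\mathfrak c_U$ as in (i), for some open antisymmetric $U\subset\Omega$. 3. $U\mapsto\mathfrak c_U$ is a bijection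 from the set of *antipodal colorings* of $\Omega$ (the open antisymmetric sets $U$ satisfying (ii)) onto the set of maximal cones of $W$. -/

import Mathlib

open scoped Pointwise ComplexOrder ZeroAtInfty

universe u

noncomputable section

/-! ### `*`-TRO's in a C*-algebra and their cones -/

/-- A `*`-TRO in a C*-algebra `A`: a norm closed, selfadjoint linear subspace `X` with
`X X* X ⊆ X`. -/
structure StarTRO (A : Type u) [NonUnitalCStarAlgebra A] where
  /-- the underlying subspace -/
  carrier : Submodule ℂ A
  isClosed' : IsClosed (carrier : Set A)
  star_mem' : ∀ x ∈ carrier, star x ∈ carrier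
  triple_mem' : ∀ x ∈ carrier, ∀ y ∈ carrier, ∀ z ∈ carrier, x * star y * z ∈ carrier

namespace StarTRO

variable {A : Type u} [NonUnitalCStarAlgebra A]

/-- The involution of a `*`-TRO. -/
def adj (X : StarTRO A) (x : X.carrier) : X.carrier :=
  ⟨star (x : A), X.star_mem' _ x.2⟩

/-- The ternary product `[x, y, z] = x y* z` of a `*`-TRO. -/
def triple (X : StarTRO A) (x y z : X.carrier) : X.carrier :=
  ⟨(x : A) * star (y : A) * (z : A), X.triple_mem' _ x.2 _ y.2 _ z.2⟩

end StarTRO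

/-- The positive elements `b* b` of a C*-algebra. -/
def IsPositiveElement {B : Type u} [NonUnitalCStarAlgebra B] (a : B) : Prop :=
  ∃ b : B, a = star b * b

/-- The C*-norm of an `n × n` matrix over a C*-algebra `B`, i.e. its norm in the C*-algebra
`M_n(B)`. (The order on `B` that Mathlib needs for this norm is the usual one of a C*-algebra.) -/
def matrixNorm {B : Type u} [NonUnitalCStarAlgebra B] {n : ℕ}
    (M : Matrix (Fin n) (Fin n) B) : ℝ :=
  letI : PartialOrder B := CStarAlgebra.spectralOrder B
  letI : StarOrderedRing B := CStarAlgebra.spectralOrderedRing B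
  ‖CStarMatrix.ofMatrix M‖

section Cones

variable {A : Type u} [NonUnitalCStarAlgebra A] (X : StarTRO A)

/-- `T` is `*`-linear (selfadjoint). -/
def IsStarLinear {B : Type u} [NonUnitalCStarAlgebra B] (T : X.carrier →ₗ[ℂ] B) : Prop :=
  ∀ x, T (X.adj x) = star (T x)

/-- `T` is a ternary morphism. -/
def IsTernaryMorphism {B : Type u} [NonUnitalCStarAlgebra B] (T : X.carrier →ₗ[ℂ] B) : Prop :=
  ∀ x y z, T (X.triple x y z) = T x * star (T y) * T z

/-- `T` is completely isometric: all its amplifications `M_n(X) → M_n(B)` preserve the matrix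
norms, where the matrix norms of `X` are inherited from the containing C*-algebra. -/
def IsCompletelyIsometric {B : Type u} [NonUnitalCStarAlgebra B] (T : X.carrier →ₗ[ℂ] B) : Prop :=
  ∀ (n : ℕ) (M : Matrix (Fin n) (Fin n) X.carrier),
    matrixNorm (M.map T) = matrixNorm (M.map fun x : X.carrier => (x : A))

/-- `𝔠` is a natural cone on `X`: there is a ternary `*`-isomorphism `T` of `X` onto a `*`-TRO `Y`
in some C*-algebra `B` such that `𝔠` is the pull-back of the cone which `Y` inherits from `B`. -/
def IsNaturalCone (𝔠 : Set X.carrier) : Prop :=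
  ∃ (B : Type u) (_ : NonUnitalCStarAlgebra B) (Y : StarTRO B) (T : X.carrier →ₗ[ℂ] B),
    IsStarLinear X T ∧ IsTernaryMorphism X T ∧ Function.Injective T ∧
      LinearMap.range T = Y.carrier ∧ 𝔠 = {x | IsPositiveElement (T x)}

/-- `𝔠` is an ordered operator space cone on `X`: there is a completely isometric `*`-linear map
`T` of `X` into some C*-algebra `B` such that `𝔠` is the pull-back of the cone of `B`. (The
matrix cones of this ordering are the pull-backs of the cones of `M_n(B)`.) -/
def IsOrderedOperatorSpaceCone (𝔠 : Set X.carrier) : Prop :=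
  ∃ (B : Type u) (_ : NonUnitalCStarAlgebra B) (T : X.carrier →ₗ[ℂ] B),
    IsStarLinear X T ∧ IsCompletelyIsometric X T ∧ 𝔠 = {x | IsPositiveElement (T x)}

/-- `𝔠` is a maximal natural cone: maximal for inclusion among the natural cones. -/
def IsMaximalNaturalCone (𝔠 : Set X.carrier) : Prop :=
  Maximal (IsNaturalCone X) 𝔠

/-- `𝔠` is a maximal cone: maximal for inclusion among all ordered operator space cones. -/
def IsMaximalCone (𝔠 : Set X.carrier) : Prop :=
  Maximal (IsOrderedOperatorSpaceCone X) 𝔠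

end Cones

section Commutative

variable (Z : Type u) [NormedAddCommGroup Z] [NormedSpace ℂ Z] [StarAddMonoid Z]

/-- A complex normed space `Z` with an involution and a ternary product `p` is a commutative
involutive ternary system: it is isometric, through a `*`-linear ternary morphism, to a `*`-TRO in
a commutative C*-algebra. (Its operator space structure is then the one of this `*`-TRO.) -/
def IsCommInvolutiveTernarySystem (p : Z → Z → Z → Z) : Prop :=
  ∃ (B : Type u) (_ : NonUnitalCommCStarAlgebra B) (Y : StarTRO B) (T : Z →ₗᵢ[ℂ] B),
    LinearMap.range T.toLinearMap = Y.carrier ∧ (∀ z, T (star z) = star (T z)) ∧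
      ∀ x y z, T (p x y z) = T x * star (T y) * T z

/-- The unit ball of the real space of selfadjoint functionals `φ` on `Z`, those with
`φ (z*)` the conjugate of `φ z`. -/
def selfAdjointDualBall : Set (WeakDual ℂ Z) :=
  {φ | ‖WeakDual.toStrongDual φ‖ ≤ 1 ∧ ∀ z, φ (star z) = star (φ z)}

/-- The space `Ω` of extreme points of the ball of selfadjoint functionals; as a type it
carries the weak* topology. -/
def Omega : Set (WeakDual ℂ Z) :=
  (selfAdjointDualBall Z).extremePoints ℝ

variable {Z}

theorem neg_mem_selfAdjointDualBall {φ : WeakDual ℂ Z} (h : φ ∈ selfAdjointDualBall Z) :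
    -φ ∈ selfAdjointDualBall Z := by
  refine ⟨?_, fun z => ?_⟩
  · rw [map_neg, norm_neg]
    exact h.1
  · change -(φ (star z)) = star (-(φ z))
    rw [h.2 z, star_neg]

theorem neg_mem_Omega {φ : WeakDual ℂ Z} (h : φ ∈ Omega Z) : -φ ∈ Omega Z := by
  refine ⟨neg_mem_selfAdjointDualBall h.1, fun x hx y hy hxy => ?_⟩
  have key : φ ∈ openSegment ℝ (-x) (-y) := by
    obtain ⟨a, b, ha, hb, hab, he⟩ := hxy
    exact ⟨a, b, ha, hb, hab, by rw [smul_neg, smul_neg, ← neg_add, he, neg_neg]⟩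
  have := h.2 (neg_mem_selfAdjointDualBall hx) (neg_mem_selfAdjointDualBall hy) key
  rw [← this, neg_neg]

/-- The change of sign on `Ω`; for a subset `U` of `Ω`, `-U` is its image under it. -/
instance : Neg (Omega Z) := ⟨fun φ => ⟨-φ.1, neg_mem_Omega φ.2⟩⟩

variable (Z)

/-- The `*`-TRO `W = {f ∈ C₀(Ω) : f (-ψ) = - f ψ for all ψ ∈ Ω}` in the C*-algebra `C₀(Ω)`. -/
def oddTRO : StarTRO C₀(Omega Z, ℂ) where
  carrier :=
    { carrier := {f | ∀ ψ, f (-ψ) = -f ψ}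
      add_mem' := by
        intro f g hf hg ψ
        rw [ZeroAtInftyContinuousMap.add_apply, ZeroAtInftyContinuousMap.add_apply, hf ψ, hg ψ]
        ring
      zero_mem' := by
        intro ψ
        simp
      smul_mem' := by
        intro c f hf ψ
        rw [ZeroAtInftyContinuousMap.smul_apply, ZeroAtInftyContinuousMap.smul_apply, hf ψ,
          smul_neg] }
  isClosed' := by
    have hc : ∀ ψ : Omega Z, Continuous fun f : C₀(Omega Z, ℂ) => f ψ := fun ψ => by
      exact (BoundedContinuousFunction.lipschitz_eval_const (β := ℂ) ψ).continuous.comp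
        (ZeroAtInftyContinuousMap.isometry_toBCF (α := Omega Z) (β := ℂ)).continuous
    have : {f : C₀(Omega Z, ℂ) | ∀ ψ, f (-ψ) = -f ψ} = ⋂ ψ, {f | f (-ψ) = -f ψ} := by
      ext f
      simp
    change IsClosed {f : C₀(Omega Z, ℂ) | ∀ ψ, f (-ψ) = -f ψ}
    rw [this]
    exact isClosed_iInter fun ψ => isClosed_eq (hc _) (hc _).neg
  star_mem' := by
    intro f hf ψ
    change star (f (-ψ)) = -star (f ψ)
    rw [hf ψ, star_neg]
  triple_mem' := by
    intro f hf g hg h hh ψ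
    change f (-ψ) * star (g (-ψ)) * h (-ψ) = -(f ψ * star (g ψ) * h ψ)
    rw [hf ψ, hg ψ, hh ψ, star_neg]
    ring

variable {Z}

/-- A subset `U` of `Ω` is antisymmetric if `U ∩ (-U) = ∅`. -/
def IsAntisymmetric (U : Set (Omega Z)) : Prop :=
  U ∩ -U = ∅

/-- The cone `𝔠_U` of those `f ∈ W` with `f ≥ 0` on `U` (in particular real valued there) and
`f = 0` off `U ∪ -U`. -/
def coneOf (U : Set (Omega Z)) : Set (oddTRO Z).carrier :=
  {f | (∀ x ∈ U, 0 ≤ f.1 x) ∧ ∀ x ∈ (U ∪ -U)ᶜ, f.1 x = 0}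

/-- An antipodal coloring of `Ω`: an open antisymmetric set whose boundary is the complement
of `U ∪ -U`. -/
def IsAntipodalColoring (U : Set (Omega Z)) : Prop :=
  IsOpen U ∧ IsAntisymmetric U ∧ (U ∪ -U)ᶜ = frontier U

end Commutative

end

/-!
# Maximal cones of commutative involutive ternary systems

Embed `Z` isometrically in some `C(K)`, so that the ternary product becomes `f g* h`.

*The extreme points are the nonzero triple characters.* For `x` selfadjoint in the unit ball, an
extreme `φ` is the sum of `φ (x² ·)` and `φ ((1 - x²) ·)`, whose norms add up to at most `1`; so
both are multiples of `φ`, and polarization gives `φ (x y z) = κ φ(x) φ(y) φ(z)`. That `κ = 1`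
follows from the fact that `u³` and `(3 u - u³) / 2` stay in the unit ball with `u`
(`IsFunctionModel.mul_norm_sq_eq_one`). Conversely, if `φ` is a nonzero triple character and
`φ z = 0`, then the elements `u - u z² + ε z`, with `φ u` close to `1` and norm at most
`1 + ε² / 4`, show that all functionals in a convex decomposition of `φ` vanish at `z`
(`IsFunctionModel.apply_eq_zero_of_convex`).

*The isomorphism.* Together with `0`, the triple characters form a weak* compact space, so `Ω` is
locally compact. Functions on this space that are a sum of an even function multiplying `Z` into
itself and of an element of `Z` form a separating `*`-subalgebra; by the Stone-Weierstrass theorem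
it is dense, and taking odd parts shows that every odd function is an evaluation
(`IsFunctionModel.evalIsometry_surjective`).

*Cones.* For every antisymmetric `U`, multiplication by the sign that is `-1` on `-U` and `1`
elsewhere is a completely isometric ternary `*`-morphism into the bounded functions on `Ω`, and it
pulls the pointwise order back to `𝔠_U`. So `𝔠_U` is both a natural cone and an ordered operator
space cone. On the other hand, two elements of a cone of either kind cannot have strictly opposite
signs at a point of `Ω` (`IsNaturalCone.exists_subset_coneOf` and
`IsOrderedOperatorSpaceCone.exists_subset_coneOf`), whence the cone lies in `𝔠_U` for the open
antisymmetric set `U` of points where one of its elements is positive. As `𝔠_U ⊆ 𝔠_U'` if and only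
if `U ⊆ U'`, both kinds of maximal cones are the `𝔠_U` with `U` maximal, and it remains to describe
the maximal open antisymmetric sets topologically (`compl_eq_frontier_iff_maximal`).
-/

noncomputable section

/-! ### Function models of commutative involutive ternary systems -/

/-- A function model of an involutive space `Z` with ternary product `p`: an isometric `*`-linear
map `T` into some `C(K)` turning `p` into the pointwise product `f g* h`. -/
structure IsFunctionModel {Z : Type*} [NormedAddCommGroup Z] [NormedSpace ℂ Z] [StarAddMonoid Z]
    (p : Z → Z → Z → Z) {K : Type*} [TopologicalSpace K] [CompactSpace K]
    (T : Z →ₗᵢ[ℂ] C(K, ℂ)) : Prop where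
  map_star : ∀ z, T (star z) = star (T z)
  map_triple : ∀ x y z, T (p x y z) = T x * star (T y) * T z

section Model

variable {Z : Type u} [NormedAddCommGroup Z] [NormedSpace ℂ Z] [StarAddMonoid Z]

theorem IsCommInvolutiveTernarySystem.completeSpace {p : Z → Z → Z → Z}
    (hZ : IsCommInvolutiveTernarySystem Z p) : CompleteSpace Z := by
  obtain ⟨B, _, Y, T, hY, -, -⟩ := hZ
  have hr : IsClosed (Set.range T) := by
    have h : Set.range T = (Y.carrier : Set B) := by
      rw [← hY]
      rfl
    rw [h]
    exact Y.isClosed'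
  exact (completeSpace_iff_isComplete_range T.isometry.isUniformInducing).2 hr.isComplete

/-- Function models come from the Gelfand representation of the unitization of the enveloping
commutative C*-algebra. -/
theorem IsCommInvolutiveTernarySystem.exists_isFunctionModel {p : Z → Z → Z → Z}
    (hZ : IsCommInvolutiveTernarySystem Z p) :
    ∃ (K : Type u) (_ : TopologicalSpace K) (_ : CompactSpace K) (T : Z →ₗᵢ[ℂ] C(K, ℂ)),
      IsFunctionModel p T := by
  obtain ⟨B, _, Y, T, -, hs, hp⟩ := hZ
  let G : B →⋆ₙₐ[ℂ] C(WeakDual.characterSpace ℂ (Unitization ℂ B), ℂ) :=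
    (gelfandStarTransform (Unitization ℂ B)).toNonUnitalStarAlgHom.comp
      (Unitization.inrNonUnitalStarAlgHom ℂ B)
  have hG : ∀ b, ‖G b‖ = ‖b‖ := fun b =>
    (((gelfandTransform_isometry (Unitization ℂ B)).norm_map_of_map_zero (map_zero _) _).trans
      (Unitization.norm_inr b) :)
  refine ⟨_, _, inferInstance,
    ⟨(G : B →ₗ[ℂ] C(WeakDual.characterSpace ℂ (Unitization ℂ B), ℂ)).comp T.toLinearMap,
      fun z => (hG _).trans (T.norm_map z)⟩, fun z => ?_, fun x y z => ?_⟩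
  · change G (T (star z)) = star (G (T z))
    rw [hs, map_star]
  · change G (T (p x y z)) = G (T x) * star (G (T y)) * G (T z)
    rw [hp, map_mul, map_mul, map_star]

end Model

section FunctionModel

variable {Z : Type u} [NormedAddCommGroup Z] [NormedSpace ℂ Z] [StarAddMonoid Z]
  {p : Z → Z → Z → Z} {K : Type*} [TopologicalSpace K] [CompactSpace K] {T : Z →ₗᵢ[ℂ] C(K, ℂ)}

namespace IsFunctionModel

variable (hT : IsFunctionModel p T)
include hT

theorem norm_star (z : Z) : ‖star z‖ = ‖z‖ := by
  rw [← T.norm_map, hT.map_star, _root_.norm_star, T.norm_map]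

theorem norm_triple_le (x y z : Z) : ‖p x y z‖ ≤ ‖x‖ * ‖y‖ * ‖z‖ := by
  rw [← T.norm_map, hT.map_triple]
  calc _ ≤ ‖T x‖ * ‖star (T y)‖ * ‖T z‖ :=
        (norm_mul_le _ _).trans (by gcongr; exact norm_mul_le _ _)
    _ = _ := by rw [_root_.norm_star, T.norm_map, T.norm_map, T.norm_map]

theorem star_triple (x y z : Z) : star (p x y z) = p (star x) (star y) (star z) := by
  apply T.injective
  simp only [hT.map_star, hT.map_triple, star_mul, star_star]
  ring

theorem isSelfAdjoint_triple {x y z : Z} (hx : IsSelfAdjoint x) (hy : IsSelfAdjoint y)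
    (hz : IsSelfAdjoint z) : IsSelfAdjoint (p x y z) := by
  rw [IsSelfAdjoint, hT.star_triple, hx.star_eq, hy.star_eq, hz.star_eq]

theorem apply_im {z : Z} (hz : IsSelfAdjoint z) (k : K) : (T z k).im = 0 := by
  have h := congrArg (fun f : C(K, ℂ) => f k) (hT.map_star z)
  rw [hz.star_eq] at h
  exact Complex.conj_eq_iff_im.1 h.symm

theorem apply_eq_ofReal {z : Z} (hz : IsSelfAdjoint z) (k : K) : T z k = ((T z k).re : ℂ) :=
  Complex.ext rfl (by simp [hT.apply_im hz k])

omit hT [StarAddMonoid Z] in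
theorem norm_apply_le (T : Z →ₗᵢ[ℂ] C(K, ℂ)) (z : Z) (k : K) : ‖T z k‖ ≤ ‖z‖ :=
  ((T z).norm_coe_le_norm k).trans_eq (T.norm_map z)

omit hT [StarAddMonoid Z] in
theorem abs_re_apply_le (T : Z →ₗᵢ[ℂ] C(K, ℂ)) (z : Z) (k : K) : |(T z k).re| ≤ ‖z‖ :=
  (Complex.abs_re_le_norm _).trans (norm_apply_le T z k)

theorem norm_le_of_abs_re_le {z : Z} (hz : IsSelfAdjoint z) {r : ℝ} (hr : 0 ≤ r)
    (h : ∀ k, |(T z k).re| ≤ r) : ‖z‖ ≤ r := by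
  rw [← T.norm_map, ContinuousMap.norm_le _ hr]
  intro k
  rw [hT.apply_eq_ofReal hz k, Complex.norm_real]
  exact h k

theorem triple_add_right (x y z w : Z) : p x y (z + w) = p x y z + p x y w := by
  apply T.injective
  simp only [hT.map_triple, map_add]
  ring

theorem triple_smul_right (x y z : Z) (c : ℂ) : p x y (c • z) = c • p x y z := by
  apply T.injective
  simp only [hT.map_triple, map_smul, mul_smul_comm]

theorem triple_add_middle (x y z w : Z) : p x (y + z) w = p x y w + p x z w := by
  apply T.injective
  simp only [hT.map_triple, map_add, star_add]
  ring

theorem triple_smul_middle [StarModule ℂ Z] (x y z : Z) (c : ℂ) :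
    p x (c • y) z = star c • p x y z := by
  apply T.injective
  simp only [hT.map_triple, map_smul, star_smul, mul_smul_comm, smul_mul_assoc]

theorem triple_comm (x y z : Z) : p x y z = p z y x := by
  apply T.injective
  simp only [hT.map_triple]
  ring

theorem triple_comm_of_isSelfAdjoint {x y : Z} (hx : IsSelfAdjoint x) (hy : IsSelfAdjoint y)
    (z : Z) : p x y z = p y x z := by
  apply T.injective
  rw [hT.map_triple, hT.map_triple, ← hT.map_star, ← hT.map_star, hx.star_eq, hy.star_eq]
  ring

end IsFunctionModel

/-! ### Selfadjoint functionals -/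

omit [StarAddMonoid Z] in
theorem norm_apply_le_norm_toStrongDual (φ : WeakDual ℂ Z) (z : Z) :
    ‖φ z‖ ≤ ‖WeakDual.toStrongDual φ‖ * ‖z‖ :=
  (WeakDual.toStrongDual φ).le_opNorm z

omit [StarAddMonoid Z] in
theorem re_apply_le_norm_toStrongDual (φ : WeakDual ℂ Z) {z : Z} (hz : ‖z‖ ≤ 1) :
    (φ z).re ≤ ‖WeakDual.toStrongDual φ‖ :=
  (Complex.re_le_norm _).trans ((norm_apply_le_norm_toStrongDual φ z).trans
    (mul_le_of_le_one_right (norm_nonneg _) hz))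

theorem apply_eq_ofReal_of_isSelfAdjoint {φ : WeakDual ℂ Z} (hφ : ∀ z, φ (star z) = star (φ z))
    {z : Z} (hz : IsSelfAdjoint z) : φ z = ((φ z).re : ℂ) := by
  have h := hφ z
  rw [hz.star_eq] at h
  exact (Complex.conj_eq_iff_re.1 h.symm).symm

theorem exists_isSelfAdjoint_add_I_smul [StarModule ℂ Z] (z : Z) :
    ∃ a b : Z, IsSelfAdjoint a ∧ IsSelfAdjoint b ∧ z = a + Complex.I • b :=
  ⟨realPart z, imaginaryPart z, (realPart z).2, (imaginaryPart z).2,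
    (realPart_add_I_smul_imaginaryPart z).symm⟩

theorem ext_of_isSelfAdjoint [StarModule ℂ Z] {φ χ : WeakDual ℂ Z}
    (h : ∀ z, IsSelfAdjoint z → φ z = χ z) : φ = χ := by
  refine DFunLike.ext _ _ fun z => ?_
  obtain ⟨a, b, ha, hb, rfl⟩ := exists_isSelfAdjoint_add_I_smul z
  rw [map_add, map_add, map_smul, map_smul, h a ha, h b hb]

theorem exists_isSelfAdjoint_apply_eq_one [StarModule ℂ Z] {φ : WeakDual ℂ Z}
    (hφ : ∀ z, φ (star z) = star (φ z)) (h0 : φ ≠ 0) : ∃ u, IsSelfAdjoint u ∧ φ u = 1 := by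
  by_contra! h
  refine h0 (ext_of_isSelfAdjoint fun z hz => ?_)
  change φ z = 0
  by_contra hne
  have hr := apply_eq_ofReal_of_isSelfAdjoint hφ hz
  have hre : (φ z).re ≠ 0 := fun h0 => hne (by rw [hr, h0]; simp)
  refine h (((φ z).re⁻¹ : ℂ) • z) ?_ ?_
  · rw [IsSelfAdjoint, star_smul, hz.star_eq]
    simp
  · rw [map_smul, hr, smul_eq_mul, Complex.ofReal_re, inv_mul_cancel₀]
    exact_mod_cast hre

/-- The norm of a selfadjoint functional is the supremum of its values on the selfadjoint part of
the unit ball. -/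
theorem IsFunctionModel.exists_lt_re_apply [StarModule ℂ Z] (hT : IsFunctionModel p T)
    {φ : WeakDual ℂ Z} (hφ : ∀ z, φ (star z) = star (φ z)) {r : ℝ}
    (hr : r < ‖WeakDual.toStrongDual φ‖) :
    ∃ u, IsSelfAdjoint u ∧ ‖u‖ ≤ 1 ∧ r < (φ u).re := by
  obtain ⟨z, hz, hrz⟩ := (WeakDual.toStrongDual φ).exists_lt_apply_of_lt_opNorm hr
  change r < ‖φ z‖ at hrz
  obtain ⟨c, hc, hcz⟩ : ∃ c : ℂ, ‖c‖ = 1 ∧ c * φ z = ‖φ z‖ := by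
    rcases eq_or_ne (φ z) 0 with h0 | h0
    · exact ⟨1, by simp, by simp [h0]⟩
    · refine ⟨star (φ z) / ‖φ z‖, by simp [h0], ?_⟩
      rw [div_mul_eq_mul_div, div_eq_iff (by simpa using h0), Complex.star_def,
        ← Complex.normSq_eq_conj_mul_self, Complex.normSq_eq_norm_sq]
      push_cast
      ring
  have hw : ‖c • z‖ ≤ 1 := by rw [norm_smul, hc, one_mul]; exact hz.le
  refine ⟨(1 / 2 : ℂ) • (c • z + star (c • z)), ?_, ?_, ?_⟩
  · simp [IsSelfAdjoint, star_smul, add_comm]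
  · rw [norm_smul]
    have := norm_add_le (c • z) (star (c • z))
    rw [hT.norm_star] at this
    have h2 : ‖(1 / 2 : ℂ)‖ = 1 / 2 := by norm_num
    rw [h2]
    linarith
  · rw [map_smul, map_add, hφ, map_smul, smul_eq_mul, smul_eq_mul, hcz]
    simpa [← two_mul] using hrz

/-- If a nonzero selfadjoint functional is `κ`-cubic, `φ (u³) = κ φ(u)³`, then `κ ‖φ‖² = 1`: let
`φ u` tend to `‖φ‖` and use that `u³` and `(3 u - u³) / 2` remain in the unit ball. -/
theorem IsFunctionModel.mul_norm_sq_eq_one [StarModule ℂ Z] (hT : IsFunctionModel p T)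
    {φ : WeakDual ℂ Z} (hφ : ∀ z, φ (star z) = star (φ z)) (h0 : φ ≠ 0) {κ : ℝ}
    (hκ : ∀ u, IsSelfAdjoint u → (φ (p u u u)).re = κ * (φ u).re ^ 3) :
    κ * ‖WeakDual.toStrongDual φ‖ ^ 2 = 1 := by
  set c := ‖WeakDual.toStrongDual φ‖ with hc
  have hcpos : 0 < c := norm_pos_iff.2 (by simpa using h0)
  let S : Set ℝ := {t | ∃ u, IsSelfAdjoint u ∧ ‖u‖ ≤ 1 ∧ t = (φ u).re}
  have hcS : c ∈ closure S := by
    refine Metric.mem_closure_iff.2 fun ε hε => ?_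
    obtain ⟨u, hu, hu1, hlt⟩ := hT.exists_lt_re_apply hφ (sub_lt_self c hε)
    refine ⟨_, ⟨u, hu, hu1, rfl⟩, ?_⟩
    have := re_apply_le_norm_toStrongDual φ hu1
    rw [Real.dist_eq, abs_lt]
    constructor <;> linarith
  have hS : S ⊆ {t | κ * t ^ 3 ≤ c ∧ 3 * t - κ * t ^ 3 ≤ 2 * c} := by
    rintro _ ⟨u, hu, hu1, rfl⟩
    have hu3 : IsSelfAdjoint (p u u u) := hT.isSelfAdjoint_triple hu hu hu
    constructor
    · rw [← hκ u hu]
      refine re_apply_le_norm_toStrongDual φ ((hT.norm_triple_le u u u).trans ?_)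
      exact mul_le_one₀ (mul_le_one₀ hu1 (norm_nonneg _) hu1) (norm_nonneg _) hu1
    · have hw : ‖(3 : ℂ) • u - p u u u‖ ≤ 2 := by
        refine hT.norm_le_of_abs_re_le ?_ zero_le_two fun k => ?_
        · rw [IsSelfAdjoint, star_sub, star_smul, hu.star_eq, hu3.star_eq]
          simp
        · have h1 := abs_le.1 ((IsFunctionModel.abs_re_apply_le T u k).trans hu1)
          have h2 : (T ((3 : ℂ) • u - p u u u) k).re = 3 * (T u k).re - (T u k).re ^ 3 := by
            rw [map_sub, map_smul, hT.map_triple, ← hT.map_star, hu.star_eq]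
            change ((3 : ℂ) * T u k - T u k * T u k * T u k).re = _
            rw [hT.apply_eq_ofReal hu k]
            norm_cast
            ring
          rw [h2, abs_le]
          constructor
          · nlinarith [mul_nonneg (sq_nonneg ((T u k).re + 1)) (by linarith : 0 ≤ 2 - (T u k).re)]
          · nlinarith [mul_nonneg (sq_nonneg ((T u k).re - 1)) (by linarith : 0 ≤ 2 + (T u k).re)]
      have h3 : (φ ((3 : ℂ) • u - p u u u)).re ≤ c * 2 :=
        (Complex.re_le_norm _).trans ((norm_apply_le_norm_toStrongDual φ _).trans (by gcongr))
      rw [map_sub, map_smul, Complex.sub_re, hκ u hu] at h3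
      have h4 : ((3 : ℂ) • φ u).re = 3 * (φ u).re := by simp
      rw [h4] at h3
      linarith
  have hcl : IsClosed {t : ℝ | κ * t ^ 3 ≤ c ∧ 3 * t - κ * t ^ 3 ≤ 2 * c} :=
    IsClosed.and (isClosed_le (by fun_prop) (by fun_prop)) (isClosed_le (by fun_prop) (by fun_prop))
  obtain ⟨h1, h2⟩ := closure_minimal hS hcl hcS
  have h3 : κ * c ^ 2 * c = 1 * c := by
    rw [one_mul]
    apply le_antisymm
    · calc _ = κ * c ^ 3 := by ring
        _ ≤ c := h1
    · calc c ≤ κ * c ^ 3 := by linarith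
        _ = _ := by ring
  exact mul_right_cancel₀ hcpos.ne' h3

end FunctionModel

/-! ### Extreme points are the nonzero triple characters -/

section Characters

variable {Z : Type u} [NormedAddCommGroup Z] [NormedSpace ℂ Z] [StarAddMonoid Z]

/-- The triple characters of `Z`: selfadjoint functionals that are multiplicative for the ternary
product. The zero functional is included. -/
def tripleCharacters (p : Z → Z → Z → Z) : Set (WeakDual ℂ Z) :=
  {φ | (∀ z, φ (star z) = star (φ z)) ∧ ∀ x y z, φ (p x y z) = φ x * star (φ y) * φ z}

variable {p : Z → Z → Z → Z} {K : Type*} [TopologicalSpace K] [CompactSpace K]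
  {T : Z →ₗᵢ[ℂ] C(K, ℂ)}

/-- Evaluation at a point of the space of a function model. -/
def evalCharacter (T : Z →ₗᵢ[ℂ] C(K, ℂ)) (k : K) : WeakDual ℂ Z :=
  StrongDual.toWeakDual ((ContinuousMap.evalCLM ℂ k).comp T.toContinuousLinearMap)

omit [StarAddMonoid Z] in
theorem evalCharacter_apply (T : Z →ₗᵢ[ℂ] C(K, ℂ)) (k : K) (z : Z) :
    evalCharacter T k z = T z k := rfl

theorem IsFunctionModel.evalCharacter_mem (hT : IsFunctionModel p T) (k : K) :
    evalCharacter T k ∈ tripleCharacters p := by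
  refine ⟨fun z => ?_, fun x y z => ?_⟩
  · rw [evalCharacter_apply, hT.map_star]
    rfl
  · rw [evalCharacter_apply, hT.map_triple]
    rfl

/-- The triple characters norm `Z`. -/
theorem IsFunctionModel.exists_norm_eq_norm_evalCharacter (hT : IsFunctionModel p T) {z : Z}
    (hz : z ≠ 0) : ∃ φ ∈ tripleCharacters p, φ ≠ 0 ∧ ‖φ z‖ = ‖z‖ := by
  have hne : Nonempty K := by
    by_contra h
    rw [not_nonempty_iff] at h
    exact hz (T.injective (by ext k; exact h.elim k))
  obtain ⟨k, hk⟩ := ((T z).continuous.norm).exists_forall_ge_of_hasCompactSupport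
    (HasCompactSupport.of_compactSpace _)
  have hn : ‖evalCharacter T k z‖ = ‖z‖ := by
    apply le_antisymm (IsFunctionModel.norm_apply_le T z k)
    rw [← T.norm_map, ContinuousMap.norm_le _ (norm_nonneg _)]
    exact hk
  refine ⟨_, hT.evalCharacter_mem k, fun h0 => ?_, hn⟩
  rw [h0] at hn
  exact hz (norm_eq_zero.1 (hn.symm.trans norm_zero))

variable [StarModule ℂ Z]

theorem IsFunctionModel.norm_eq_one (hT : IsFunctionModel p T) {φ : WeakDual ℂ Z}
    (hφ : φ ∈ tripleCharacters p) (h0 : φ ≠ 0) : ‖WeakDual.toStrongDual φ‖ = 1 := by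
  have h := hT.mul_norm_sq_eq_one hφ.1 h0 (κ := 1) fun u hu => by
    rw [hφ.2, apply_eq_ofReal_of_isSelfAdjoint hφ.1 hu]
    simp only [Complex.star_def, Complex.conj_ofReal]
    norm_cast
    ring
  rw [one_mul] at h
  exact (pow_eq_one_iff_of_nonneg (norm_nonneg _) two_ne_zero).1 h

theorem IsFunctionModel.norm_le_one (hT : IsFunctionModel p T) {φ : WeakDual ℂ Z}
    (hφ : φ ∈ tripleCharacters p) : ‖WeakDual.toStrongDual φ‖ ≤ 1 := by
  by_cases h0 : φ = 0
  · rw [h0, map_zero, norm_zero]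
    exact zero_le_one
  · exact (hT.norm_eq_one hφ h0).le

/-- A selfadjoint `z` in the kernel of a triple character `φ` is in the kernel of every functional
`ξ` of the ball that occurs in a convex decomposition of `φ`. With `φ u` close to `1`, the element
`u - u z² + ε z` has norm at most `1 + ε² / 4`, while `ξ (u - u z²)` is close to `1`. -/
theorem IsFunctionModel.apply_eq_zero_of_convex (hT : IsFunctionModel p T) {φ ξ η : WeakDual ℂ Z}
    (hφ : φ ∈ tripleCharacters p) (h0 : φ ≠ 0) (hξ : ξ ∈ selfAdjointDualBall Z)
    (hη : η ∈ selfAdjointDualBall Z) {a b : ℝ} (ha : 0 < a) (hb : 0 ≤ b) (hab : a + b = 1)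
    (hc : a • ξ + b • η = φ) {z : Z} (hz : IsSelfAdjoint z) (hφz : φ z = 0) : ξ z = 0 := by
  -- the upper estimate, for `z` in the unit ball
  have key : ∀ w : Z, IsSelfAdjoint w → ‖w‖ ≤ 1 → φ w = 0 → (ξ w).re ≤ 0 := by
    intro w hw hw1 hφw
    have hε : ∀ ε : ℝ, 0 < ε → (ξ w).re ≤ ε / 4 := by
      intro ε hε
      have hδ : ∀ δ : ℝ, 0 < δ → a * ε * (ξ w).re ≤ a * ε ^ 2 / 4 + δ := by
        intro δ hδ
        obtain ⟨u, hu, hu1, hφu⟩ := hT.exists_lt_re_apply hφ.1 (r := 1 - δ)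
          (by rw [hT.norm_eq_one hφ h0]; linarith)
        have hv : IsSelfAdjoint (u - p w w u) := hu.sub (hT.isSelfAdjoint_triple hw hw hu)
        have hre : ∀ k, (T (u - p w w u) k).re = (T u k).re * (1 - (T w k).re ^ 2) := fun k => by
          rw [map_sub, hT.map_triple, ← hT.map_star, hw.star_eq]
          change (T u k - T w k * T w k * T u k).re = _
          rw [hT.apply_eq_ofReal hu k, hT.apply_eq_ofReal hw k]
          norm_cast
          ring
        have hle : ∀ k, |(T (u - p w w u) k).re| ≤ 1 - (T w k).re ^ 2 := fun k => by
          have h1 := (IsFunctionModel.abs_re_apply_le T u k).trans hu1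
          have h2 := (IsFunctionModel.abs_re_apply_le T w k).trans hw1
          have h3 : 0 ≤ 1 - (T w k).re ^ 2 := sub_nonneg.2 ((sq_le_one_iff_abs_le_one _).2 h2)
          rw [hre, abs_mul, abs_of_nonneg h3]
          exact mul_le_of_le_one_left h3 h1
        have hv1 : ‖u - p w w u‖ ≤ 1 := hT.norm_le_of_abs_re_le hv zero_le_one fun k =>
          (hle k).trans (by linarith [sq_nonneg (T w k).re])
        have hεw : IsSelfAdjoint ((ε : ℂ) • w) := by
          rw [IsSelfAdjoint, star_smul, hw.star_eq]
          simp
        have hvw : ‖u - p w w u + (ε : ℂ) • w‖ ≤ 1 + ε ^ 2 / 4 := by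
          refine hT.norm_le_of_abs_re_le (hv.add hεw) (by positivity) fun k => ?_
          have h1 : (T (u - p w w u + (ε : ℂ) • w) k).re
              = (T (u - p w w u) k).re + ε * (T w k).re := by
            rw [map_add, map_smul]
            simp
          have h2 := abs_le.1 (hle k)
          rw [h1, abs_le]
          constructor <;> nlinarith [sq_nonneg ((T w k).re - ε / 2), sq_nonneg ((T w k).re + ε / 2)]
        have hξvw : (ξ (u - p w w u + (ε : ℂ) • w)).re ≤ 1 + ε ^ 2 / 4 :=
          (Complex.re_le_norm _).trans ((norm_apply_le_norm_toStrongDual ξ _).trans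
            ((mul_le_of_le_one_left (norm_nonneg _) hξ.1).trans hvw))
        have hadd : (ξ (u - p w w u + (ε : ℂ) • w)).re
            = (ξ (u - p w w u)).re + ε * (ξ w).re := by
          rw [map_add, map_smul]
          simp
        have hηv := (re_apply_le_norm_toStrongDual η hv1).trans hη.1
        have hφv : a * (ξ (u - p w w u)).re + b * (η (u - p w w u)).re = (φ u).re := by
          have h1 : φ (u - p w w u) = φ u := by
            rw [map_sub, hφ.2, hφw]
            simp
          rw [← h1, ← hc]
          change _ = (a • ξ (u - p w w u) + b • η (u - p w w u)).re
          simp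
        rw [hadd] at hξvw
        have h1 : a * ((ξ (u - p w w u)).re + ε * (ξ w).re) ≤ a * (1 + ε ^ 2 / 4) := by gcongr
        have h2 : b * (η (u - p w w u)).re ≤ b * 1 := by gcongr
        linarith
      have h1 : a * ε * (ξ w).re ≤ a * ε * (ε / 4) :=
        (le_of_forall_pos_le_add hδ).trans_eq (by ring)
      exact le_of_mul_le_mul_left h1 (by positivity)
    refine le_of_forall_pos_le_add fun ε h => ?_
    have := hε ε h
    linarith
  -- the estimate for `z` and `-z`, after scaling
  have hs : ∀ w : Z, IsSelfAdjoint w → φ w = 0 → (ξ w).re ≤ 0 := by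
    intro w hw hφw
    have hpos : 0 < (1 + ‖w‖)⁻¹ := by positivity
    have h := key ((((1 + ‖w‖)⁻¹ : ℝ) : ℂ) • w) ?_ ?_ ?_
    · rw [map_smul, smul_eq_mul, Complex.re_ofReal_mul] at h
      exact nonpos_of_mul_nonpos_right h hpos
    · rw [IsSelfAdjoint, star_smul, hw.star_eq]
      simp
    · rw [norm_smul, Complex.norm_real, Real.norm_of_nonneg hpos.le,
        inv_mul_le_one₀ (by positivity)]
      linarith
    · rw [map_smul, hφw, smul_zero]
  have h1 := hs z hz hφz
  have h2 := hs (-z) hz.neg (by rw [map_neg, hφz, neg_zero])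
  rw [map_neg, Complex.neg_re] at h2
  rw [apply_eq_ofReal_of_isSelfAdjoint hξ.2 hz, le_antisymm h1 (by linarith), Complex.ofReal_zero]

theorem IsFunctionModel.exists_eq_smul_of_convex (hT : IsFunctionModel p T) {φ ξ η : WeakDual ℂ Z}
    (hφ : φ ∈ tripleCharacters p) (h0 : φ ≠ 0) (hξ : ξ ∈ selfAdjointDualBall Z)
    (hη : η ∈ selfAdjointDualBall Z) {a b : ℝ} (ha : 0 < a) (hb : 0 ≤ b) (hab : a + b = 1)
    (hc : a • ξ + b • η = φ) : ∃ r : ℝ, r ≤ 1 ∧ ξ = r • φ := by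
  obtain ⟨u, hu, hφu⟩ := exists_isSelfAdjoint_apply_eq_one hφ.1 h0
  have hξu := apply_eq_ofReal_of_isSelfAdjoint hξ.2 hu
  have heq : ξ = (ξ u).re • φ := by
    refine ext_of_isSelfAdjoint fun z hz => ?_
    have hφz := apply_eq_ofReal_of_isSelfAdjoint hφ.1 hz
    have h := hT.apply_eq_zero_of_convex hφ h0 hξ hη ha hb hab hc (z := z - φ z • u)
      (hz.sub (by
        rw [IsSelfAdjoint, star_smul, hu.star_eq, hφz]
        simp))
      (by rw [map_sub, map_smul, hφu]; simp)
    rw [map_sub, map_smul, sub_eq_zero] at h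
    change ξ z = (ξ u).re • φ z
    rw [h, hξu]
    simp [mul_comm]
  refine ⟨_, ?_, heq⟩
  have h1 : ‖WeakDual.toStrongDual ξ‖ = |(ξ u).re| := by
    conv_lhs => rw [heq]
    change ‖(ξ u).re • WeakDual.toStrongDual φ‖ = _
    rw [norm_smul, hT.norm_eq_one hφ h0, mul_one, Real.norm_eq_abs]
  exact (le_abs_self _).trans (h1.symm.trans_le hξ.1)

/-- Nonzero triple characters are extreme: all members of a convex decomposition are multiples. -/
theorem IsFunctionModel.mem_Omega_of_mem_tripleCharacters (hT : IsFunctionModel p T)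
    {φ : WeakDual ℂ Z} (hφ : φ ∈ tripleCharacters p) (h0 : φ ≠ 0) : φ ∈ Omega Z := by
  refine ⟨⟨hT.norm_le_one hφ, hφ.1⟩, ?_⟩
  rintro ξ hξ η hη ⟨a, b, ha, hb, hab, hc⟩
  obtain ⟨r, hr, rfl⟩ := hT.exists_eq_smul_of_convex hφ h0 hξ hη ha hb.le hab hc
  obtain ⟨s, hs, rfl⟩ := hT.exists_eq_smul_of_convex hφ h0 hη hξ hb ha.le
    ((add_comm _ _).trans hab) ((add_comm _ _).trans hc)
  rw [smul_smul a r φ, smul_smul b s φ, ← add_smul (a * r) (b * s) φ] at hc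
  have h1 : a * r + b * s = 1 := by
    obtain ⟨u, -, hu⟩ := exists_isSelfAdjoint_apply_eq_one hφ.1 h0
    have h := congrArg (fun χ : WeakDual ℂ Z => χ u) hc
    change (a * r + b * s) • φ u = φ u at h
    rw [hu] at h
    simpa using congrArg Complex.re h
  have h2 : r = 1 := by
    have h3 : b * s ≤ b * 1 := by gcongr
    have h4 : a * 1 ≤ a * r := by linarith
    exact le_antisymm hr (le_of_mul_le_mul_left h4 ha)
  rw [h2, one_smul ℝ φ]

theorem IsFunctionModel.ne_zero_of_mem_Omega [Nontrivial Z] (hT : IsFunctionModel p T)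
    {φ : WeakDual ℂ Z} (hφ : φ ∈ Omega Z) : φ ≠ 0 := by
  rintro rfl
  obtain ⟨z, hz⟩ := exists_ne (0 : Z)
  obtain ⟨ψ, hψ, hψ0, -⟩ := hT.exists_norm_eq_norm_evalCharacter hz
  have hb : ψ ∈ selfAdjointDualBall Z := ⟨hT.norm_le_one hψ, hψ.1⟩
  refine hψ0 (hφ.2 hb (neg_mem_selfAdjointDualBall hb) ⟨1 / 2, 1 / 2, ?_⟩)
  norm_num

omit [StarModule ℂ Z] in
theorem norm_eq_one_of_mem_Omega {φ : WeakDual ℂ Z} (hφ : φ ∈ Omega Z) (h0 : φ ≠ 0) :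
    ‖WeakDual.toStrongDual φ‖ = 1 := by
  set c := ‖WeakDual.toStrongDual φ‖ with hc
  have hcpos : 0 < c := norm_pos_iff.2 (by simpa using h0)
  refine le_antisymm hφ.1.1 (not_lt.1 fun hlt => h0 ?_)
  have h1 : c⁻¹ • φ ∈ selfAdjointDualBall Z := by
    refine ⟨?_, fun z => ?_⟩
    · change ‖c⁻¹ • WeakDual.toStrongDual φ‖ ≤ 1
      rw [norm_smul, norm_inv, Real.norm_of_nonneg hcpos.le, inv_mul_cancel₀ hcpos.ne']
    · change c⁻¹ • φ (star z) = star (c⁻¹ • φ z)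
      rw [hφ.1.2, star_smul, star_trivial c⁻¹]
  have h2 : (0 : WeakDual ℂ Z) ∈ selfAdjointDualBall Z := by
    refine ⟨?_, fun z => ?_⟩
    · rw [map_zero, norm_zero]
      exact zero_le_one
    · exact (star_zero ℂ).symm
  refine (hφ.2 h2 h1 ⟨1 - c, c, by linarith, hcpos, by ring, ?_⟩).symm
  rw [smul_zero, zero_add, smul_smul c c⁻¹ φ, mul_inv_cancel₀ hcpos.ne', one_smul ℝ φ]

/-- Multiplication by `x²`, for `x` selfadjoint in the unit ball, acts on an extreme functional as
a scalar: the norms of `φ (x² ·)` and `φ ((1 - x²) ·)` add up to at most `1`, hence both are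
multiples of their sum `φ`. -/
theorem IsFunctionModel.exists_apply_triple_eq_mul (hT : IsFunctionModel p T)
    {φ : WeakDual ℂ Z} (hφ : φ ∈ Omega Z) (h0 : φ ≠ 0) {x : Z} (hx : IsSelfAdjoint x)
    (hx1 : ‖x‖ ≤ 1) : ∃ r : ℝ, ∀ f, φ (p x x f) = r * φ f := by
  let L : Z →L[ℂ] Z := LinearMap.mkContinuous
    { toFun := p x x
      map_add' := hT.triple_add_right x x
      map_smul' := fun c z => hT.triple_smul_right x x z c } 1 fun z => by
    rw [one_mul]
    exact (hT.norm_triple_le x x z).trans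
      (mul_le_of_le_one_left (norm_nonneg _) (mul_le_one₀ hx1 (norm_nonneg _) hx1))
  let φ₁ : WeakDual ℂ Z := StrongDual.toWeakDual ((WeakDual.toStrongDual φ).comp L)
  let φ₂ : WeakDual ℂ Z := φ - φ₁
  have e1 : ∀ f, φ₁ f = φ (p x x f) := fun f => rfl
  have e2 : ∀ f, φ₂ f = φ (f - p x x f) := fun f => (map_sub φ f (p x x f)).symm
  have s1 : ∀ z, φ₁ (star z) = star (φ₁ z) := fun z => by
    rw [e1, e1, ← hφ.1.2, hT.star_triple, hx.star_eq]
  have s2 : ∀ z, φ₂ (star z) = star (φ₂ z) := fun z => by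
    rw [e2, e2, ← hφ.1.2, star_sub, hT.star_triple, hx.star_eq]
  have hφ1 := norm_eq_one_of_mem_Omega hφ h0
  have hsum : ‖WeakDual.toStrongDual φ₁‖ + ‖WeakDual.toStrongDual φ₂‖ ≤ 1 := by
    refine le_of_forall_pos_le_add fun ε hε => ?_
    obtain ⟨u, hu, hu1, hlu⟩ := hT.exists_lt_re_apply s1
      (sub_lt_self ‖WeakDual.toStrongDual φ₁‖ (half_pos hε))
    obtain ⟨v, hv, hv1, hlv⟩ := hT.exists_lt_re_apply s2
      (sub_lt_self ‖WeakDual.toStrongDual φ₂‖ (half_pos hε))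
    have hw : ‖p x x u + (v - p x x v)‖ ≤ 1 := by
      refine hT.norm_le_of_abs_re_le ((hT.isSelfAdjoint_triple hx hx hu).add
        (hv.sub (hT.isSelfAdjoint_triple hx hx hv))) zero_le_one fun k => ?_
      have hre : (T (p x x u + (v - p x x v)) k).re
          = (T x k).re ^ 2 * (T u k).re + (1 - (T x k).re ^ 2) * (T v k).re := by
        rw [map_add, map_sub, hT.map_triple, hT.map_triple, ← hT.map_star, hx.star_eq]
        change (T x k * T x k * T u k + (T v k - T x k * T x k * T v k)).re = _
        rw [hT.apply_eq_ofReal hu k, hT.apply_eq_ofReal hv k, hT.apply_eq_ofReal hx k]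
        norm_cast
        ring
      have h1 := abs_le.1 ((IsFunctionModel.abs_re_apply_le T u k).trans hu1)
      have h2 := abs_le.1 ((IsFunctionModel.abs_re_apply_le T v k).trans hv1)
      have h3 : 0 ≤ 1 - (T x k).re ^ 2 := sub_nonneg.2
        ((sq_le_one_iff_abs_le_one _).2 ((IsFunctionModel.abs_re_apply_le T x k).trans hx1))
      rw [hre, abs_le]
      constructor
      · nlinarith [mul_nonneg (sq_nonneg (T x k).re) (by linarith : 0 ≤ (T u k).re + 1),
          mul_nonneg h3 (by linarith : 0 ≤ (T v k).re + 1)]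
      · nlinarith [mul_nonneg (sq_nonneg (T x k).re) (by linarith : 0 ≤ 1 - (T u k).re),
          mul_nonneg h3 (by linarith : 0 ≤ 1 - (T v k).re)]
    have h1 := re_apply_le_norm_toStrongDual φ hw
    rw [map_add, ← e1, ← e2, Complex.add_re, hφ1] at h1
    linarith
  have hadd : φ₁ + φ₂ = φ := add_sub_cancel φ₁ φ
  have htri : 1 ≤ ‖WeakDual.toStrongDual φ₁‖ + ‖WeakDual.toStrongDual φ₂‖ := by
    rw [← hφ1, ← hadd, map_add]
    exact norm_add_le _ _
  set α := ‖WeakDual.toStrongDual φ₁‖ with hα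
  set β := ‖WeakDual.toStrongDual φ₂‖ with hβ
  rcases (norm_nonneg _ : 0 ≤ α).eq_or_lt with hα0 | hα0
  · refine ⟨0, fun f => ?_⟩
    have h : φ₁ = 0 := by simpa using norm_eq_zero.1 hα0.symm
    rw [← e1, h, Complex.ofReal_zero, zero_mul]
    rfl
  rcases (norm_nonneg _ : 0 ≤ β).eq_or_lt with hβ0 | hβ0
  · refine ⟨1, fun f => ?_⟩
    have h : φ₂ = 0 := by simpa using norm_eq_zero.1 hβ0.symm
    rw [h, add_zero] at hadd
    rw [← e1, hadd, Complex.ofReal_one, one_mul]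
  have ball : ∀ χ : WeakDual ℂ Z, (∀ z, χ (star z) = star (χ z)) →
      0 < ‖WeakDual.toStrongDual χ‖ → ‖WeakDual.toStrongDual χ‖⁻¹ • χ ∈ selfAdjointDualBall Z := by
    refine fun χ hχ hpos => ⟨?_, fun z => ?_⟩
    · change ‖‖WeakDual.toStrongDual χ‖⁻¹ • WeakDual.toStrongDual χ‖ ≤ 1
      rw [norm_smul, norm_inv, norm_norm, inv_mul_cancel₀ hpos.ne']
    · change ‖WeakDual.toStrongDual χ‖⁻¹ • χ (star z)
        = star (‖WeakDual.toStrongDual χ‖⁻¹ • χ z)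
      rw [hχ, star_smul, star_trivial ‖WeakDual.toStrongDual χ‖⁻¹]
  have h := hφ.2 (ball φ₁ s1 hα0) (ball φ₂ s2 hβ0)
    ⟨α, β, hα0, hβ0, le_antisymm hsum htri, by
      rw [smul_smul α α⁻¹ φ₁, smul_smul β β⁻¹ φ₂, mul_inv_cancel₀ hα0.ne',
        mul_inv_cancel₀ hβ0.ne', one_smul ℝ φ₁, one_smul ℝ φ₂, hadd]⟩
  refine ⟨α, fun f => ?_⟩
  have h1 : φ₁ = α • φ := by
    rw [← h, smul_smul α α⁻¹ φ₁, mul_inv_cancel₀ hα0.ne', one_smul ℝ φ₁]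
  rw [← e1, h1]
  change α • φ f = _
  simp

/-- An extreme functional `φ` is a triple character. With `φ u = 1`, the identities
`φ (x² f) = φ (x² u) φ(f)` polarize to `φ (x y f) = φ (x y u) φ(f)`, and by the symmetry of the
product `φ (x y f) = κ φ(x) φ(y) φ(f)` with `κ = φ (u³)`. -/
theorem IsFunctionModel.mem_tripleCharacters_of_mem_Omega [Nontrivial Z]
    (hT : IsFunctionModel p T) {φ : WeakDual ℂ Z} (hφ : φ ∈ Omega Z) :
    φ ∈ tripleCharacters p := by
  have h0 := hT.ne_zero_of_mem_Omega hφ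
  have hsa : ∀ z, φ (star z) = star (φ z) := hφ.1.2
  obtain ⟨u, hu, hu1⟩ := exists_isSelfAdjoint_apply_eq_one hsa h0
  have hsq : ∀ x f, IsSelfAdjoint x → φ (p x x f) = φ (p x x u) * φ f := by
    intro x f hx
    have hpos : (0 : ℝ) < (1 + ‖x‖)⁻¹ := by positivity
    set c : ℂ := (((1 + ‖x‖)⁻¹ : ℝ) : ℂ) with hc
    have hcs : star c = c := Complex.conj_ofReal _
    have hc0 : c ≠ 0 := by
      rw [hc]
      exact_mod_cast hpos.ne'
    obtain ⟨r, hr⟩ := hT.exists_apply_triple_eq_mul hφ h0 (x := c • x)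
      (by rw [IsSelfAdjoint, star_smul, hx.star_eq, hcs])
      (by
        rw [norm_smul, Complex.norm_real, Real.norm_of_nonneg hpos.le,
          inv_mul_le_one₀ (by positivity)]
        linarith)
    have hsc : ∀ f, p (c • x) (c • x) f = (c * c) • p x x f := fun f => by
      rw [hT.triple_comm, hT.triple_smul_right, hT.triple_comm, hT.triple_smul_middle, hcs,
        smul_smul]
    have h1 := hr f
    have h2 := hr u
    rw [hsc, map_smul, smul_eq_mul] at h1 h2
    rw [hu1, mul_one] at h2
    apply mul_left_cancel₀ (mul_ne_zero hc0 hc0)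
    rw [h1, ← h2]
    ring
  have hprod : ∀ x y f, IsSelfAdjoint x → IsSelfAdjoint y → φ (p x y f) = φ (p x y u) * φ f := by
    intro x y f hx hy
    have hexp : ∀ f, φ (p (x + y) (x + y) f)
        = φ (p x x f) + 2 * φ (p x y f) + φ (p y y f) := fun f => by
      rw [hT.triple_comm, hT.triple_add_right, hT.triple_comm, hT.triple_comm _ _ y,
        hT.triple_add_middle, hT.triple_add_middle, hT.triple_comm_of_isSelfAdjoint hy hx,
        map_add, map_add, map_add]
      ring
    have h1 := hsq (x + y) f (hx.add hy)
    rw [hexp, hexp, hsq x f hx, hsq y f hy] at h1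
    linear_combination h1 / 2
  set κ := φ (p u u u) with hκ
  have hcub : ∀ x y f, IsSelfAdjoint x → IsSelfAdjoint y → φ (p x y f) = κ * φ x * φ y * φ f := by
    intro x y f hx hy
    rw [hprod x y f hx hy, hT.triple_comm, hT.triple_comm_of_isSelfAdjoint hu hy,
      hT.triple_comm_of_isSelfAdjoint hy hu, hprod u y x hu hy,
      hT.triple_comm_of_isSelfAdjoint hu hy, hT.triple_comm, hprod u u y hu hu]
    ring
  have hκr := apply_eq_ofReal_of_isSelfAdjoint hsa (hT.isSelfAdjoint_triple hu hu hu)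
  have hκ1 : κ = 1 := by
    have h := hT.mul_norm_sq_eq_one hsa h0 (κ := κ.re) fun x hx => by
      rw [hcub x x x hx hx, hκ, hκr, apply_eq_ofReal_of_isSelfAdjoint hsa hx]
      norm_cast
      ring
    rw [norm_eq_one_of_mem_Omega hφ h0, one_pow, mul_one] at h
    rw [hκ, hκr, h, Complex.ofReal_one]
  refine ⟨hsa, fun x y z => ?_⟩
  obtain ⟨a, b, ha, hb, rfl⟩ := exists_isSelfAdjoint_add_I_smul x
  obtain ⟨c, d, hc, hd, rfl⟩ := exists_isSelfAdjoint_add_I_smul y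
  have hstar : ∀ w, IsSelfAdjoint w → star (φ w) = φ w := fun w hw => by
    rw [← hsa, hw.star_eq]
  have hmid : ∀ w, IsSelfAdjoint w →
      φ (p w (c + Complex.I • d) z) = φ w * star (φ (c + Complex.I • d)) * φ z := fun w hw => by
    rw [hT.triple_add_middle, hT.triple_smul_middle, map_add, map_add, map_smul, map_smul,
      hcub w c z hw hc, hcub w d z hw hd, hκ1, star_add, star_smul, hstar c hc, hstar d hd]
    simp only [smul_eq_mul]
    ring
  rw [hT.triple_comm, hT.triple_add_right, hT.triple_smul_right, hT.triple_comm,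
    hT.triple_comm z _ b, map_add, map_smul, hmid a ha, hmid b hb, map_add φ a,
    map_smul φ _ b]
  simp only [smul_eq_mul]
  ring

/-- The extreme points of the ball of selfadjoint functionals are the nonzero triple
characters. -/
theorem IsFunctionModel.mem_Omega_iff [Nontrivial Z] (hT : IsFunctionModel p T)
    {φ : WeakDual ℂ Z} : φ ∈ Omega Z ↔ φ ∈ tripleCharacters p ∧ φ ≠ 0 :=
  ⟨fun h => ⟨hT.mem_tripleCharacters_of_mem_Omega h, hT.ne_zero_of_mem_Omega h⟩,
    fun h => hT.mem_Omega_of_mem_tripleCharacters h.1 h.2⟩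

end Characters

/-! ### The evaluation isomorphism onto the odd functions -/

section Evaluation

variable {Z : Type u} [NormedAddCommGroup Z] [NormedSpace ℂ Z] [StarAddMonoid Z]
  {p : Z → Z → Z → Z} {K : Type*} [TopologicalSpace K] [CompactSpace K] {T : Z →ₗᵢ[ℂ] C(K, ℂ)}

theorem isClosed_tripleCharacters (p : Z → Z → Z → Z) : IsClosed (tripleCharacters p) := by
  have h : tripleCharacters p = (⋂ z, {φ : WeakDual ℂ Z | φ (star z) = star (φ z)}) ∩
      ⋂ x, ⋂ y, ⋂ z, {φ : WeakDual ℂ Z | φ (p x y z) = φ x * star (φ y) * φ z} := by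
    ext φ
    simp [tripleCharacters]
  have he : ∀ z : Z, Continuous fun φ : WeakDual ℂ Z => φ z := WeakDual.eval_continuous
  rw [h]
  exact (isClosed_iInter fun z => isClosed_eq (he _) (he _).star).inter
    (isClosed_iInter fun x => isClosed_iInter fun y => isClosed_iInter fun z =>
      isClosed_eq (he _) (((he x).mul (he y).star).mul (he z)))

theorem neg_mem_tripleCharacters {φ : WeakDual ℂ Z} (h : φ ∈ tripleCharacters p) :
    -φ ∈ tripleCharacters p := by
  refine ⟨fun z => ?_, fun x y z => ?_⟩
  · change -(φ (star z)) = star (-(φ z))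
    rw [h.1, star_neg]
  · change -(φ (p x y z)) = -(φ x) * star (-(φ y)) * -(φ z)
    rw [h.2, star_neg]
    ring

/-- The change of sign on the triple characters. -/
instance : Neg (tripleCharacters p) := ⟨fun φ => ⟨-φ.1, neg_mem_tripleCharacters φ.2⟩⟩

theorem continuous_neg_Omega : Continuous fun ψ : Omega Z => -ψ :=
  Continuous.subtype_mk continuous_subtype_val.neg _

theorem neg_neg_Omega (ψ : Omega Z) : -(-ψ) = ψ := Subtype.ext (neg_neg ψ.1)

variable [StarModule ℂ Z]

theorem IsFunctionModel.isCompact_tripleCharacters (hT : IsFunctionModel p T) :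
    IsCompact (tripleCharacters p) :=
  (WeakDual.isCompact_closedBall (0 : StrongDual ℂ Z) 1).of_isClosed_subset
    (isClosed_tripleCharacters p) fun φ hφ => by
      simpa using! hT.norm_le_one hφ

variable [Nontrivial Z]

/-- The inclusion of `Ω` into the compact space of triple characters, whose only further point
is `0`. -/
def IsFunctionModel.inclusion (hT : IsFunctionModel p T) (ψ : Omega Z) : tripleCharacters p :=
  ⟨ψ.1, (hT.mem_Omega_iff.1 ψ.2).1⟩

theorem IsFunctionModel.isOpenEmbedding_inclusion (hT : IsFunctionModel p T) :
    Topology.IsOpenEmbedding hT.inclusion := by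
  have hemb : Topology.IsEmbedding hT.inclusion :=
    Topology.IsEmbedding.of_comp (Continuous.subtype_mk continuous_subtype_val _)
      continuous_subtype_val Topology.IsEmbedding.subtypeVal
  refine ⟨hemb, ?_⟩
  have hr : Set.range hT.inclusion = {φ | φ.1 ≠ 0} := by
    ext φ
    constructor
    · rintro ⟨ψ, rfl⟩
      exact (hT.mem_Omega_iff.1 ψ.2).2
    · intro h
      exact ⟨⟨φ.1, hT.mem_Omega_iff.2 ⟨φ.2, h⟩⟩, rfl⟩
  rw [hr]
  exact isOpen_ne_fun continuous_subtype_val continuous_const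

theorem IsFunctionModel.locallyCompactSpace_Omega (hT : IsFunctionModel p T) :
    LocallyCompactSpace (Omega Z) := by
  have : CompactSpace (tripleCharacters p) :=
    isCompact_iff_compactSpace.1 hT.isCompact_tripleCharacters
  exact hT.isOpenEmbedding_inclusion.locallyCompactSpace

omit [Nontrivial Z] in
/-- An element of `Z` as a continuous function on the compact space of triple characters. -/
def evalTripleCharacters (p : Z → Z → Z → Z) : Z →ₗ[ℂ] C(tripleCharacters p, ℂ) where
  toFun z := ⟨fun φ => φ.1 z, (WeakDual.eval_continuous z).comp continuous_subtype_val⟩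
  map_add' x y := by
    ext φ
    exact map_add φ.1 x y
  map_smul' c x := by
    ext φ
    exact map_smul φ.1 c x

/-- Evaluation of an element of `Z` on `Ω` vanishes at infinity, since `{|ψ z| ≥ ε}` is closed in
the compact space of triple characters and misses `0`. -/
def IsFunctionModel.evalOmega (hT : IsFunctionModel p T) (z : Z) : C₀(Omega Z, ℂ) where
  toFun ψ := ψ.1 z
  continuous_toFun := (WeakDual.eval_continuous z).comp continuous_subtype_val
  zero_at_infty' := by
    rw [Metric.tendsto_nhds]
    intro ε hε
    refine Filter.mem_cocompact.2 ⟨{ψ | ε ≤ ‖ψ.1 z‖}, ?_, fun ψ hψ => ?_⟩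
    · rw [Topology.IsEmbedding.subtypeVal.isCompact_iff]
      have h : Subtype.val '' {ψ : Omega Z | ε ≤ ‖ψ.1 z‖}
          = tripleCharacters p ∩ {φ | ε ≤ ‖φ z‖} := by
        ext φ
        constructor
        · rintro ⟨ψ, hψ, rfl⟩
          exact ⟨(hT.mem_Omega_iff.1 ψ.2).1, hψ⟩
        · rintro ⟨h1, h2⟩
          refine ⟨⟨φ, hT.mem_Omega_iff.2 ⟨h1, ?_⟩⟩, h2, rfl⟩
          rintro rfl
          have h3 : ε ≤ ‖(0 : ℂ)‖ := h2
          rw [norm_zero] at h3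
          exact hε.not_ge h3
      rw [h]
      exact hT.isCompact_tripleCharacters.inter_right
        (isClosed_le continuous_const (WeakDual.eval_continuous z).norm)
    · simpa using hψ

theorem IsFunctionModel.norm_evalOmega (hT : IsFunctionModel p T) (z : Z) :
    ‖hT.evalOmega z‖ = ‖z‖ := by
  rw [← ZeroAtInftyContinuousMap.norm_toBCF_eq_norm]
  apply le_antisymm
  · rw [BoundedContinuousFunction.norm_le (norm_nonneg _)]
    intro ψ
    exact (norm_apply_le_norm_toStrongDual ψ.1 z).trans
      (mul_le_of_le_one_left (norm_nonneg _) ψ.2.1.1)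
  · rcases eq_or_ne z 0 with rfl | hz
    · rw [norm_zero]
      exact norm_nonneg _
    · obtain ⟨φ, hφ, hφ0, hn⟩ := hT.exists_norm_eq_norm_evalCharacter hz
      rw [← hn]
      exact (hT.evalOmega z).toBCF.norm_coe_le_norm ⟨φ, hT.mem_Omega_of_mem_tripleCharacters hφ hφ0⟩

/-- Evaluation as an isometry of `Z` into the odd functions on `Ω`. -/
def IsFunctionModel.evalIsometry (hT : IsFunctionModel p T) : Z →ₗᵢ[ℂ] (oddTRO Z).carrier where
  toFun z := ⟨hT.evalOmega z, fun ψ => rfl⟩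
  map_add' x y := by
    ext ψ
    exact map_add ψ.1 x y
  map_smul' c x := by
    ext ψ
    exact map_smul ψ.1 c x
  norm_map' z := hT.norm_evalOmega z

/-- The functions on the triple characters that are the sum of an even function multiplying the
image `R` of `Z` into itself and of an element of `R`. -/
def evenAddEvalSubalgebra (p : Z → Z → Z → Z) :
    StarSubalgebra ℂ C(tripleCharacters p, ℂ) where
  carrier := {g | ∃ e o, g = e + o ∧ (∀ φ, e (-φ) = e φ) ∧
    (∀ r ∈ LinearMap.range (evalTripleCharacters p),
      e * r ∈ LinearMap.range (evalTripleCharacters p)) ∧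
    o ∈ LinearMap.range (evalTripleCharacters p)}
  mul_mem' := by
    rintro _ _ ⟨e, o, rfl, he, her, x, rfl⟩ ⟨e', o', rfl, he', her', x', rfl⟩
    refine ⟨e * e' + evalTripleCharacters p x * evalTripleCharacters p x',
      e * evalTripleCharacters p x' + e' * evalTripleCharacters p x, by ring, fun φ => ?_, ?_,
      Submodule.add_mem _ (her _ ⟨_, rfl⟩) (her' _ ⟨_, rfl⟩)⟩
    · change e (-φ) * e' (-φ) + -(φ.1 x) * -(φ.1 x') = e φ * e' φ + φ.1 x * φ.1 x'
      rw [he, he']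
      ring
    · rintro r ⟨z, rfl⟩
      rw [add_mul, mul_assoc]
      refine Submodule.add_mem _ (her _ (her' _ ⟨_, rfl⟩)) ⟨p x (star x') z, ?_⟩
      ext φ
      change φ.1 (p x (star x') z) = φ.1 x * φ.1 x' * φ.1 z
      rw [φ.2.2, φ.2.1, star_star]
  add_mem' := by
    rintro _ _ ⟨e, o, rfl, he, her, ho⟩ ⟨e', o', rfl, he', her', ho'⟩
    refine ⟨e + e', o + o', by ring, fun φ => ?_, fun r hr => ?_, Submodule.add_mem _ ho ho'⟩
    · rw [ContinuousMap.add_apply, ContinuousMap.add_apply, he, he']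
    · rw [add_mul]
      exact Submodule.add_mem _ (her r hr) (her' r hr)
  algebraMap_mem' c := by
    refine ⟨algebraMap ℂ _ c, 0, by simp, fun φ => rfl, fun r hr => ?_, Submodule.zero_mem _⟩
    rw [← Algebra.smul_def]
    exact Submodule.smul_mem _ c hr
  star_mem' := by
    have hs : ∀ r ∈ LinearMap.range (evalTripleCharacters p),
        star r ∈ LinearMap.range (evalTripleCharacters p) := by
      rintro _ ⟨z, rfl⟩
      exact ⟨star z, by ext φ; exact φ.2.1 z⟩
    rintro _ ⟨e, o, rfl, he, her, ho⟩
    refine ⟨star e, star o, star_add e o, fun φ => ?_, fun r hr => ?_, hs o ho⟩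
    · rw [ContinuousMap.star_apply, ContinuousMap.star_apply, he]
    · have h := hs _ (her _ (hs r hr))
      rwa [star_mul, star_star, mul_comm] at h

/-- By the Stone-Weierstrass theorem, every odd function on `Ω` is an evaluation: approximate its
extension by zero to the compact space of triple characters, and take odd parts. -/
theorem IsFunctionModel.evalIsometry_surjective [CompleteSpace Z] (hT : IsFunctionModel p T) :
    Function.Surjective hT.evalIsometry := by
  have : CompactSpace (tripleCharacters p) :=
    isCompact_iff_compactSpace.1 hT.isCompact_tripleCharacters
  have hcl : IsClosed (Set.range hT.evalIsometry) :=
    hT.evalIsometry.isometry.isClosedEmbedding.isClosed_range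
  intro f
  suffices h : f ∈ closure (Set.range hT.evalIsometry) by rwa [hcl.closure_eq] at h
  -- the extension of `f` by zero
  classical
  let F : tripleCharacters p → ℂ := fun φ =>
    if h : φ.1 = 0 then 0 else f.1 ⟨φ.1, hT.mem_Omega_iff.2 ⟨φ.2, h⟩⟩
  have hF : ∀ ψ, F (hT.inclusion ψ) = f.1 ψ := fun ψ =>
    dif_neg (hT.mem_Omega_iff.1 ψ.2).2
  have hFc : Continuous F := by
    rw [continuous_iff_continuousAt]
    intro φ
    by_cases h : φ.1 = 0
    · have h0 : F φ = 0 := dif_pos h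
      rw [ContinuousAt, h0, Metric.tendsto_nhds]
      intro ε hε
      obtain ⟨t, ht, hsub⟩ := Filter.mem_cocompact.1
        ((Metric.tendsto_nhds.1 f.1.zero_at_infty') ε hε)
      have ht' : IsClosed (hT.inclusion '' t) :=
        (ht.image hT.isOpenEmbedding_inclusion.continuous).isClosed
      refine Filter.mem_of_superset (ht'.isOpen_compl.mem_nhds ?_) fun χ hχ => ?_
      · rintro ⟨ψ, -, rfl⟩
        exact (hT.mem_Omega_iff.1 ψ.2).2 h
      · by_cases hχ0 : χ.1 = 0
        · have h1 : F χ = 0 := dif_pos hχ0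
          simpa [h1] using hε
        · have h1 : F χ = f.1 ⟨χ.1, hT.mem_Omega_iff.2 ⟨χ.2, hχ0⟩⟩ := dif_neg hχ0
          have h2 := hsub (a := ⟨χ.1, hT.mem_Omega_iff.2 ⟨χ.2, hχ0⟩⟩) fun hmem =>
            hχ ⟨⟨χ.1, hT.mem_Omega_iff.2 ⟨χ.2, hχ0⟩⟩, hmem, rfl⟩
          simpa [h1] using! h2
    · obtain ⟨ψ, rfl⟩ : ∃ ψ, hT.inclusion ψ = φ := ⟨⟨φ.1, hT.mem_Omega_iff.2 ⟨φ.2, h⟩⟩, rfl⟩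
      rw [← hT.isOpenEmbedding_inclusion.continuousAt_iff]
      have h1 : F ∘ hT.inclusion = f.1 := funext hF
      rw [h1]
      exact f.1.continuous.continuousAt
  have hdense := ContinuousMap.starSubalgebra_topologicalClosure_eq_top_of_separatesPoints
    (evenAddEvalSubalgebra p) (by
      intro φ χ hne
      obtain ⟨z, hz⟩ : ∃ z, φ.1 z ≠ χ.1 z := by
        by_contra! h
        exact hne (Subtype.ext (DFunLike.ext _ _ h))
      exact ⟨_, ⟨evalTripleCharacters p z, ⟨0, evalTripleCharacters p z, (zero_add _).symm,
        fun _ => rfl, fun r _ => by rw [zero_mul]; exact Submodule.zero_mem _, ⟨z, rfl⟩⟩, rfl⟩, hz⟩)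
  have hmem : (⟨F, hFc⟩ : C(tripleCharacters p, ℂ)) ∈
      closure (evenAddEvalSubalgebra p : Set C(tripleCharacters p, ℂ)) := by
    rw [← StarSubalgebra.topologicalClosure_coe, hdense]
    trivial
  refine Metric.mem_closure_iff.2 fun ε hε => ?_
  obtain ⟨_, ⟨e, o, rfl, he, -, z, rfl⟩, hlt⟩ := Metric.mem_closure_iff.1 hmem (ε / 2) (half_pos hε)
  refine ⟨_, ⟨z, rfl⟩, lt_of_le_of_lt ?_ (half_lt_self hε)⟩
  rw [dist_eq_norm]
  change ‖f.1 - hT.evalOmega z‖ ≤ ε / 2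
  rw [← ZeroAtInftyContinuousMap.norm_toBCF_eq_norm,
    BoundedContinuousFunction.norm_le (half_pos hε).le]
  intro ψ
  change ‖f.1 ψ - ψ.1 z‖ ≤ ε / 2
  have hd : ∀ χ : tripleCharacters p, ‖F χ - (e χ + χ.1 z)‖ ≤ ε / 2 := fun χ => by
    rw [← dist_eq_norm]
    exact (ContinuousMap.dist_apply_le_dist χ).trans hlt.le
  have h1 := hd (hT.inclusion ψ)
  have h2 := hd (hT.inclusion (-ψ))
  have h3 : e (hT.inclusion (-ψ)) = e (hT.inclusion ψ) := he (hT.inclusion ψ)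
  rw [hF] at h1 h2
  rw [f.2 ψ, h3] at h2
  change ‖f.1 ψ - (e (hT.inclusion ψ) + ψ.1 z)‖ ≤ ε / 2 at h1
  change ‖-f.1 ψ - (e (hT.inclusion ψ) + -(ψ.1 z))‖ ≤ ε / 2 at h2
  have h4 : f.1 ψ - ψ.1 z = (1 / 2 : ℂ) * ((f.1 ψ - (e (hT.inclusion ψ) + ψ.1 z))
      - (-f.1 ψ - (e (hT.inclusion ψ) + -(ψ.1 z)))) := by ring
  have h5 : ‖(1 / 2 : ℂ)‖ = 1 / 2 := by norm_num
  rw [h4, norm_mul, h5]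
  linarith [norm_sub_le (f.1 ψ - (e (hT.inclusion ψ) + ψ.1 z))
    (-f.1 ψ - (e (hT.inclusion ψ) + -(ψ.1 z)))]

end Evaluation

/-! ### Maximal antisymmetric open sets -/

section Antisymmetric

variable {X : Type*} [TopologicalSpace X] [InvolutiveNeg X] [ContinuousNeg X] {U : Set X}

theorem frontier_neg (U : Set X) : frontier (-U) = -frontier U :=
  ((Homeomorph.neg X).preimage_frontier U).symm

omit [TopologicalSpace X] [ContinuousNeg X] in
theorem neg_compl_union_neg (U : Set X) : -(U ∪ -U)ᶜ = (U ∪ -U)ᶜ := by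
  ext x
  simp [and_comm]

theorem compl_eq_frontier_neg_iff :
    (U ∪ -U)ᶜ = frontier (-U) ↔ (U ∪ -U)ᶜ = frontier U := by
  rw [frontier_neg, ← neg_compl_union_neg, neg_inj, neg_compl_union_neg]

theorem frontier_subset_compl_union_neg (hU : IsOpen U) (hd : U ∩ -U = ∅) :
    frontier U ⊆ (U ∪ -U)ᶜ := by
  intro x hx
  rw [hU.frontier_eq] at hx
  rintro (h | h)
  · exact hx.2 h
  · obtain ⟨y, hy1, hy2⟩ := mem_closure_iff.1 hx.1 (-U) hU.neg h
    exact (Set.eq_empty_iff_forall_notMem.1 hd) y ⟨hy2, hy1⟩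

theorem compl_eq_frontier_iff (hU : IsOpen U) (hd : U ∩ -U = ∅) :
    (U ∪ -U)ᶜ = frontier U ↔ frontier U = frontier (-U) ∧ interior (U ∪ -U)ᶜ = ∅ := by
  constructor
  · intro h
    exact ⟨h.symm.trans (compl_eq_frontier_neg_iff.2 h), by
      rw [h, ← frontier_compl]
      exact interior_frontier hU.isClosed_compl⟩
  · rintro ⟨h1, h2⟩
    refine Set.Subset.antisymm (fun x hx => ?_) (frontier_subset_compl_union_neg hU hd)
    rw [interior_compl, Set.compl_empty_iff] at h2
    have hc : x ∈ closure U ∪ closure (-U) := by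
      rw [← closure_union, h2]
      trivial
    rcases hc with h | h
    · rw [hU.frontier_eq]
      exact ⟨h, fun hxU => hx (Or.inl hxU)⟩
    · rw [h1, hU.neg.frontier_eq]
      exact ⟨h, fun hxU => hx (Or.inr hxU)⟩

/-- An antisymmetric open neighbourhood of `-x` can be added to `U` if `x` is neither in `U ∪ -U`
nor in the boundary of `U`. -/
theorem compl_eq_frontier_iff_maximal [T2Space X] (hne : ∀ x : X, x ≠ -x) (hU : IsOpen U)
    (hd : U ∩ -U = ∅) :
    (U ∪ -U)ᶜ = frontier U ↔ ¬ ∃ U' : Set X, IsOpen U' ∧ U' ∩ -U' = ∅ ∧ U ⊂ U' := by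
  constructor
  · rintro h ⟨U', hU', hd', hsub⟩
    obtain ⟨x, hx', hx⟩ := Set.exists_of_ssubset hsub
    have h1 : x ∈ (U ∪ -U)ᶜ := by
      rintro (h1 | h1)
      · exact hx h1
      · exact Set.eq_empty_iff_forall_notMem.1 hd' x ⟨hx', hsub.1 h1⟩
    rw [← compl_eq_frontier_neg_iff] at h
    rw [h] at h1
    obtain ⟨y, hy1, hy2⟩ := mem_closure_iff.1 h1.1 U' hU' hx'
    exact Set.eq_empty_iff_forall_notMem.1 hd' y ⟨hy1, hsub.1 hy2⟩
  · intro h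
    refine Set.Subset.antisymm (fun x hx => ?_) (frontier_subset_compl_union_neg hU hd)
    rw [hU.frontier_eq]
    refine ⟨?_, fun hxU => hx (Or.inl hxU)⟩
    by_contra hcl
    obtain ⟨A, B, hA, hB, hxA, hxB, hAB⟩ := t2_separation (hne x)
    let V := A ∩ -B ∩ (closure U)ᶜ
    have hV : IsOpen V := (hA.inter hB.neg).inter isClosed_closure.isOpen_compl
    refine h ⟨U ∪ -V, hU.union hV.neg, ?_, Set.ssubset_iff_subset_ne.2 ⟨Set.subset_union_left, ?_⟩⟩
    · rw [Set.eq_empty_iff_forall_notMem]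
      have hVU : ∀ y ∈ V, y ∉ U := fun y hy hyU => hy.2 (subset_closure hyU)
      rintro y ⟨h1 | h1, h2⟩
      · rcases h2 with h2 | h2
        · exact Set.eq_empty_iff_forall_notMem.1 hd y ⟨h1, h2⟩
        · exact hVU y (by simpa using h2) h1
      · rcases h2 with h2 | h2
        · exact hVU (-y) h1 h2
        · have h3 : y ∈ V := by simpa using h2
          exact Set.disjoint_left.1 hAB h3.1.1 (by simpa using h1.1.2)
    · intro heq
      have h1 : -x ∈ U := by
        rw [heq]
        refine Or.inr ?_
        rw [Set.mem_neg, neg_neg]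
        exact ⟨⟨hxA, hxB⟩, hcl⟩
      exact hx (Or.inr h1)

end Antisymmetric

/-! ### The cones of antisymmetric open sets -/

section ConeOf

variable {Z : Type u} [NormedAddCommGroup Z] [NormedSpace ℂ Z] [StarAddMonoid Z]

instance : InvolutiveNeg (Omega Z) := { neg_neg := neg_neg_Omega }

instance : ContinuousNeg (Omega Z) := ⟨continuous_neg_Omega⟩

theorem apply_neg_oddTRO (f : (oddTRO Z).carrier) (x : Omega Z) : f.1 (-x) = -f.1 x := f.2 x

/-- The odd function `(η x - η (-x)) G x`, for a bump function `η` and an even function `G`. -/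
def oddBump (η : C(Omega Z, ℝ)) (hη : HasCompactSupport η) (G : C(Omega Z, ℝ))
    (hG : ∀ x, G (-x) = G x) : (oddTRO Z).carrier :=
  ⟨{ toFun := fun x => (((η x - η (-x)) * G x : ℝ) : ℂ)
     continuous_toFun := by fun_prop
     zero_at_infty' := by
       have h1 : HasCompactSupport fun x => η (-x) := hη.comp_homeomorph (Homeomorph.neg _)
       have h2 : HasCompactSupport fun x => (((η x - η (-x)) * G x : ℝ) : ℂ) :=
         ((hη.sub h1).mul_right (f' := G)).comp_left (g := ((↑) : ℝ → ℂ)) Complex.ofReal_zero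
       exact h2.is_zero_at_infty }, by
    intro x
    change (((η (-x) - η (-(-x))) * G (-x) : ℝ) : ℂ) = -(((η x - η (-x)) * G x : ℝ) : ℂ)
    rw [hG, neg_neg]
    push_cast
    ring⟩

theorem oddBump_apply (η : C(Omega Z, ℝ)) (hη : HasCompactSupport η) (G : C(Omega Z, ℝ))
    (hG : ∀ x, G (-x) = G x) (x : Omega Z) :
    (oddBump η hη G hG).1 x = (((η x - η (-x)) * G x : ℝ) : ℂ) := rfl

theorem exists_bump [LocallyCompactSpace (Omega Z)] {V : Set (Omega Z)} (hV : IsOpen V)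
    {x : Omega Z} (hx : x ∈ V) : ∃ η : C(Omega Z, ℝ), HasCompactSupport η ∧ η x = 1 ∧
      (∀ y, 0 ≤ η y ∧ η y ≤ 1) ∧ ∀ y, y ∉ V → η y = 0 := by
  obtain ⟨η, h1, h0, hs, h⟩ := exists_continuous_one_zero_of_isCompact
    (isCompact_singleton (x := x)) hV.isClosed_compl (by simpa using hx)
  exact ⟨η, hs, h1 rfl, h, fun y hy => h0 hy⟩

theorem IsAntisymmetric.notMem_neg {U : Set (Omega Z)} (hU : IsAntisymmetric U) {x : Omega Z}
    (hx : x ∈ U) : -x ∉ U := fun h =>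
  Set.eq_empty_iff_forall_notMem.1 hU x ⟨hx, h⟩

theorem coneOf_subset_coneOf_iff [LocallyCompactSpace (Omega Z)] {U U' : Set (Omega Z)}
    (hU : IsOpen U) (hd : IsAntisymmetric U) (hd' : IsAntisymmetric U') :
    coneOf U ⊆ coneOf U' ↔ U ⊆ U' := by
  constructor
  · intro h x hx
    obtain ⟨η, hs, h1, h01, h0⟩ := exists_bump hU hx
    have one_even : ∀ y : Omega Z, (1 : C(Omega Z, ℝ)) (-y) = (1 : C(Omega Z, ℝ)) y :=
      fun y => by rw [ContinuousMap.one_apply, ContinuousMap.one_apply]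
    have hmem : oddBump η hs 1 one_even ∈ coneOf U := by
      refine ⟨fun y hy => ?_, fun y hy => ?_⟩
      · rw [oddBump_apply, h0 _ (hd.notMem_neg hy)]
        simpa using (h01 y).1
      · rw [oddBump_apply, h0 y fun h => hy (Or.inl h), h0 (-y) fun h => hy (Or.inr h)]
        simp
    have hval : (oddBump η hs 1 one_even).1 x = 1 := by
      rw [oddBump_apply, h0 _ (hd.notMem_neg hx), h1]
      simp
    by_contra hx'
    by_cases hxn : -x ∈ U'
    · have h2 := (h hmem).1 _ hxn
      rw [apply_neg_oddTRO, hval] at h2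
      have h3 := (Complex.le_def.1 h2).1
      norm_num at h3
    · have h2 := (h hmem).2 x (by rintro (h | h); exacts [hx' h, hxn h])
      rw [hval] at h2
      exact one_ne_zero h2
  · rintro h f ⟨hf, hf0⟩
    refine ⟨fun x hx => ?_, fun x hx => hf0 x fun hx' => hx ?_⟩
    · by_cases hxU : x ∈ U
      · exact hf x hxU
      · rw [hf0 x]
        rintro (h1 | h1)
        · exact hxU h1
        · exact hd'.notMem_neg hx (h h1)
    · exact hx'.imp (fun h1 => h h1) fun h1 => h h1

/-- A set of real odd functions no two of which have strictly opposite signs at a point is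
contained in the cone of the set of points where one of them is positive. -/
theorem exists_subset_coneOf {𝔠 : Set (oddTRO Z).carrier}
    (hre : ∀ f ∈ 𝔠, ∀ x, (f.1 x).im = 0)
    (hsign : ∀ f ∈ 𝔠, ∀ g ∈ 𝔠, ∀ x, 0 < (f.1 x).re → 0 ≤ (g.1 x).re) :
    ∃ U : Set (Omega Z), IsOpen U ∧ IsAntisymmetric U ∧ 𝔠 ⊆ coneOf U := by
  refine ⟨⋃ f ∈ 𝔠, {x | 0 < (f.1 x).re}, ?_, ?_, fun g hg => ⟨fun x hx => ?_, fun x hx => ?_⟩⟩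
  · exact isOpen_biUnion fun f _ =>
      isOpen_lt continuous_const (Complex.continuous_re.comp f.1.continuous)
  · refine Set.eq_empty_iff_forall_notMem.2 ?_
    rintro x ⟨h1, h2⟩
    obtain ⟨f, hf, hfx⟩ := Set.mem_iUnion₂.1 h1
    obtain ⟨g, hg, hgx⟩ := Set.mem_iUnion₂.1 h2
    have h3 := hsign f hf g hg x hfx
    change 0 < (g.1 (-x)).re at hgx
    rw [apply_neg_oddTRO, Complex.neg_re] at hgx
    linarith
  · obtain ⟨f, hf, hfx⟩ := Set.mem_iUnion₂.1 hx
    exact Complex.le_def.2 ⟨hsign f hf g hg x hfx, (hre g hg x).symm⟩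
  · have h1 : ¬ 0 < (g.1 x).re := fun h => hx (Or.inl (Set.mem_iUnion₂.2 ⟨g, hg, h⟩))
    have h2 : ¬ 0 < (g.1 (-x)).re := fun h => hx (Or.inr (Set.mem_iUnion₂.2 ⟨g, hg, h⟩))
    rw [apply_neg_oddTRO, Complex.neg_re] at h2
    exact Complex.ext (le_antisymm (not_lt.1 h1) (by simpa using h2)) (hre g hg x)

theorem coneOf_eq_of_compl_eq_frontier {U : Set (Omega Z)} (hU : (U ∪ -U)ᶜ = frontier U) :
    coneOf U = {f : (oddTRO Z).carrier | ∀ x ∈ U, 0 ≤ f.1 x} := by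
  refine Set.Subset.antisymm (fun f hf => hf.1) fun f hf => ⟨hf, fun x hx => ?_⟩
  have hcl : ∀ y ∈ closure U, 0 ≤ f.1 y := fun y hy =>
    closure_minimal hf (isClosed_le continuous_const f.1.continuous) hy
  have h1 : x ∈ frontier U := hU ▸ hx
  have h2 : -x ∈ frontier U := by
    rw [← neg_compl_union_neg] at hx
    exact hU ▸ hx
  have h3 := hcl _ h2.1
  rw [apply_neg_oddTRO, neg_nonneg] at h3
  exact le_antisymm h3 (hcl x h1.1)

end ConeOf

/-! ### Positive elements and matrix norms of C*-algebras -/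

section CStar

variable {A B : Type u} [NonUnitalCStarAlgebra A] [NonUnitalCStarAlgebra B]

theorem IsPositiveElement.isSelfAdjoint {a : A} (ha : IsPositiveElement a) : IsSelfAdjoint a := by
  obtain ⟨b, rfl⟩ := ha
  exact IsSelfAdjoint.star_mul_self b

theorem IsPositiveElement.eq_zero_of_neg {a : A} (ha : IsPositiveElement a)
    (hna : IsPositiveElement (-a)) : a = 0 := by
  let : PartialOrder A := CStarAlgebra.spectralOrder A
  let : StarOrderedRing A := CStarAlgebra.spectralOrderedRing A
  obtain ⟨b, hb⟩ := ha
  obtain ⟨c, hc⟩ := hna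
  refine le_antisymm (neg_nonneg.1 ?_) ?_
  · rw [hc]
    exact star_mul_self_nonneg c
  · rw [hb]
    exact star_mul_self_nonneg b

/-- In the order of the unitization, `-r ≤ a - r ≤ b ≤ b + c ≤ r`. -/
theorem norm_le_of_isPositiveElement {a b c : A} (ha : IsPositiveElement a)
    (hb : IsSelfAdjoint b) (hc : IsPositiveElement c) {r : ℝ} (hab : ‖b - a‖ ≤ r)
    (hbc : ‖b + c‖ ≤ r) : ‖b‖ ≤ r := by
  let : PartialOrder (Unitization ℂ A) := CStarAlgebra.spectralOrder _
  let : StarOrderedRing (Unitization ℂ A) := CStarAlgebra.spectralOrderedRing _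
  have hb' : IsSelfAdjoint (b : Unitization ℂ A) := by
    rw [IsSelfAdjoint, ← Unitization.inr_star, hb.star_eq]
  have hpos : ∀ {x : A}, IsPositiveElement x → (0 : Unitization ℂ A) ≤ x := by
    rintro _ ⟨y, rfl⟩
    rw [Unitization.inr_mul, Unitization.inr_star]
    exact star_mul_self_nonneg _
  have hr : 0 ≤ r := (norm_nonneg _).trans hab
  have halg : ∀ {s : ℝ}, s ≤ r → algebraMap ℝ (Unitization ℂ A) s ≤ algebraMap ℝ _ r := fun h =>
    algebraMap_mono _ h
  have hsa1 : IsSelfAdjoint ((b - a : A) : Unitization ℂ A) := by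
    rw [IsSelfAdjoint, ← Unitization.inr_star, (hb.sub ha.isSelfAdjoint).star_eq]
  have hsa2 : IsSelfAdjoint ((b + c : A) : Unitization ℂ A) := by
    rw [IsSelfAdjoint, ← Unitization.inr_star, (hb.add hc.isSelfAdjoint).star_eq]
  have hn : ∀ x : A, ‖(x : Unitization ℂ A)‖ = ‖x‖ := fun x => Unitization.norm_inr x
  have h1 : algebraMap ℝ (Unitization ℂ A) (-r) ≤ b := by
    have h2 := hsa1.neg_algebraMap_norm_le_self
    rw [hn] at h2
    calc algebraMap ℝ (Unitization ℂ A) (-r) = -algebraMap ℝ (Unitization ℂ A) r := map_neg _ r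
      _ ≤ -algebraMap ℝ (Unitization ℂ A) ‖b - a‖ := neg_le_neg (halg hab)
      _ ≤ ((b - a : A) : Unitization ℂ A) := h2
      _ ≤ b := by
        rw [Unitization.inr_sub]
        exact sub_le_self _ (hpos ha)
  have h2 : (b : Unitization ℂ A) ≤ algebraMap ℝ (Unitization ℂ A) r := by
    have h3 := hsa2.le_algebraMap_norm_self
    rw [hn] at h3
    calc (b : Unitization ℂ A) ≤ ((b + c : A) : Unitization ℂ A) := by
          rw [Unitization.inr_add]
          exact le_add_of_nonneg_right (hpos hc)
      _ ≤ algebraMap ℝ (Unitization ℂ A) ‖b + c‖ := h3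
      _ ≤ _ := halg hbc
  rw [algebraMap_le_iff_le_spectrum hb'] at h1
  rw [le_algebraMap_iff_spectrum_le hb'] at h2
  have h3 : ‖cfc (id : ℝ → ℝ) (b : Unitization ℂ A)‖ ≤ r :=
    norm_cfc_le hr fun x hx => abs_le.2 ⟨h1 x hx, h2 x hx⟩
  rwa [cfc_id ℝ (b : Unitization ℂ A) hb', hn] at h3

theorem norm_ofMatrix_eq_of_star_mul [PartialOrder A] [StarOrderedRing A] [PartialOrder B]
    [StarOrderedRing B] (ι : A →⋆ₙₐ[ℂ] B) (hι : Function.Injective ι) {n : ℕ}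
    (M : Matrix (Fin n) (Fin n) A) (N : Matrix (Fin n) (Fin n) B)
    (h : ∀ i j k l, star (N i j) * N k l = ι (star (M i j) * M k l)) :
    ‖CStarMatrix.ofMatrix N‖ = ‖CStarMatrix.ofMatrix M‖ := by
  have hinj : Function.Injective (CStarMatrix.mapₙₐ (n := Fin n) ι) := by
    intro P Q hPQ
    ext i j
    exact hι (congrFun (congrFun hPQ i) j)
  have h1 : star (CStarMatrix.ofMatrix N) * CStarMatrix.ofMatrix N =
      CStarMatrix.mapₙₐ ι (star (CStarMatrix.ofMatrix M) * CStarMatrix.ofMatrix M) := by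
    ext i j
    change ∑ k, star (N k i) * N k j = ι (∑ k, star (M k i) * M k j)
    rw [map_sum]
    exact Finset.sum_congr rfl fun k _ => h k i k j
  have h2 : ‖CStarMatrix.ofMatrix N‖ * ‖CStarMatrix.ofMatrix N‖ =
      ‖CStarMatrix.ofMatrix M‖ * ‖CStarMatrix.ofMatrix M‖ := by
    rw [← CStarRing.norm_star_mul_self, ← CStarRing.norm_star_mul_self, h1,
      NonUnitalStarAlgHom.norm_map _ hinj]
  exact (mul_self_inj (norm_nonneg _) (norm_nonneg _)).1 h2

theorem isCompletelyIsometric_of_star_mul (X : StarTRO A) (T : X.carrier →ₗ[ℂ] B)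
    (ι : A →⋆ₙₐ[ℂ] B) (hι : Function.Injective ι)
    (h : ∀ x y, star (T x) * T y = ι (star (x : A) * (y : A))) : IsCompletelyIsometric X T := by
  intro n M
  let : PartialOrder A := CStarAlgebra.spectralOrder A
  let : StarOrderedRing A := CStarAlgebra.spectralOrderedRing A
  let : PartialOrder B := CStarAlgebra.spectralOrder B
  let : StarOrderedRing B := CStarAlgebra.spectralOrderedRing B
  exact norm_ofMatrix_eq_of_star_mul ι hι _ _ fun i j k l => h _ _

theorem matrixNorm_one_by_one (a : A) :
    matrixNorm (Matrix.of fun _ _ : Fin 1 => a) = ‖a‖ := by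
  let : PartialOrder A := CStarAlgebra.spectralOrder A
  let : StarOrderedRing A := CStarAlgebra.spectralOrderedRing A
  exact NonUnitalStarAlgHom.norm_map (CStarMatrix.toOneByOne (Fin 1) ℂ A).toNonUnitalStarAlgHom
    (CStarMatrix.toOneByOne (Fin 1) ℂ A).injective a

theorem IsCompletelyIsometric.norm_map {X : StarTRO A} {T : X.carrier →ₗ[ℂ] B}
    (hT : IsCompletelyIsometric X T) (x : X.carrier) : ‖T x‖ = ‖x‖ := by
  have h := hT 1 (Matrix.of fun _ _ => x)
  exact (matrixNorm_one_by_one (T x)).symm.trans (h.trans (matrixNorm_one_by_one (x : A)))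

/-- The pull-back of the cone of `B` under an isometric ternary `*`-morphism is a natural cone:
isometry makes the range closed. -/
theorem isNaturalCone_of_isometry (X : StarTRO A) (T : X.carrier →ₗ[ℂ] B)
    (hs : IsStarLinear X T) (ht : IsTernaryMorphism X T) (hn : ∀ x, ‖T x‖ = ‖x‖) :
    IsNaturalCone X {x | IsPositiveElement (T x)} := by
  let T' : X.carrier →ₗᵢ[ℂ] B := ⟨T, hn⟩
  have : CompleteSpace X.carrier := X.isClosed'.completeSpace_coe
  refine ⟨B, inferInstance, ⟨LinearMap.range T, ?_, ?_, ?_⟩, T, hs, ht, T'.injective, rfl, rfl⟩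
  · exact T'.isometry.isClosedEmbedding.isClosed_range
  · rintro _ ⟨x, rfl⟩
    exact ⟨X.adj x, hs x⟩
  · rintro _ ⟨x, rfl⟩ _ ⟨y, rfl⟩ _ ⟨z, rfl⟩
    exact ⟨X.triple x y z, ht x y z⟩

end CStar

/-! ### The cone of an antisymmetric set as a pull-back -/

section SignChange

open scoped ENNReal

variable {Z : Type u} [NormedAddCommGroup Z] [NormedSpace ℂ Z] [StarAddMonoid Z]

theorem isPositiveElement_lp_iff {ι : Type u} (a : lp (fun _ : ι => ℂ) ∞) :
    IsPositiveElement a ↔ ∀ i, 0 ≤ a i := by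
  constructor
  · rintro ⟨b, rfl⟩ i
    rw [lp.infty_coeFn_mul]
    exact star_mul_self_nonneg (b i)
  · intro h
    refine ⟨⟨fun i => (Real.sqrt (a i).re : ℂ), memℓp_infty ⟨Real.sqrt ‖a‖, ?_⟩⟩, ?_⟩
    · rintro _ ⟨i, rfl⟩
      change ‖(Real.sqrt (a i).re : ℂ)‖ ≤ Real.sqrt ‖a‖
      rw [Complex.norm_real, Real.norm_of_nonneg (Real.sqrt_nonneg _)]
      exact Real.sqrt_le_sqrt ((Complex.re_le_norm _).trans
        (lp.norm_apply_le_norm ENNReal.top_ne_zero a i))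
    · ext i
      have hi := Complex.le_def.1 (h i)
      rw [lp.infty_coeFn_mul]
      change a i = star (Real.sqrt (a i).re : ℂ) * (Real.sqrt (a i).re : ℂ)
      rw [Complex.star_def, Complex.conj_ofReal, ← Complex.ofReal_mul, Real.mul_self_sqrt hi.1]
      exact Complex.ext rfl hi.2.symm

/-- The inclusion of `C₀(X)` into the C*-algebra of all bounded functions on `X`. -/
def zeroAtInftyToLp (X : Type u) [TopologicalSpace X] :
    C₀(X, ℂ) →⋆ₙₐ[ℂ] lp (fun _ : X => ℂ) ∞ where
  toFun f := ⟨fun x => f x, memℓp_infty ⟨‖f‖, by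
    rintro _ ⟨x, rfl⟩
    exact f.toBCF.norm_coe_le_norm x⟩⟩
  map_smul' c f := rfl
  map_zero' := rfl
  map_add' f g := rfl
  map_mul' f g := rfl
  map_star' f := rfl

open scoped Classical in
/-- The sign that is `-1` on `-U` and `1` elsewhere. -/
def antipodalSign (U : Set (Omega Z)) (x : Omega Z) : ℝ := if x ∈ -U then -1 else 1

theorem antipodalSign_mul_self (U : Set (Omega Z)) (x : Omega Z) :
    antipodalSign U x * antipodalSign U x = 1 := by
  unfold antipodalSign
  split_ifs <;> norm_num

theorem norm_antipodalSign (U : Set (Omega Z)) (x : Omega Z) :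
    ‖(antipodalSign U x : ℂ)‖ = 1 := by
  unfold antipodalSign
  split_ifs <;> simp

/-- Multiplication of the odd functions by the sign of `U`, with values in the bounded functions
on `Ω`. It is a completely isometric ternary `*`-morphism, and it pulls the pointwise order back
to the cone of `U`. -/
def signChange (U : Set (Omega Z)) : (oddTRO Z).carrier →ₗ[ℂ] lp (fun _ : Omega Z => ℂ) ∞ where
  toFun f := ⟨fun x => antipodalSign U x * f.1 x, memℓp_infty ⟨‖f.1‖, by
    rintro _ ⟨x, rfl⟩
    change ‖(antipodalSign U x : ℂ) * f.1 x‖ ≤ ‖f.1‖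
    rw [norm_mul, norm_antipodalSign, one_mul]
    exact f.1.toBCF.norm_coe_le_norm x⟩⟩
  map_add' f g := by
    ext x
    exact mul_add _ _ _
  map_smul' c f := by
    ext x
    exact mul_left_comm _ _ _

theorem signChange_apply (U : Set (Omega Z)) (f : (oddTRO Z).carrier) (x : Omega Z) :
    signChange U f x = antipodalSign U x * f.1 x := rfl

theorem isStarLinear_signChange (U : Set (Omega Z)) :
    IsStarLinear (oddTRO Z) (signChange U) := by
  intro f
  ext x
  change (antipodalSign U x : ℂ) * star (f.1 x) = star ((antipodalSign U x : ℂ) * f.1 x)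
  rw [star_mul', Complex.star_def, Complex.conj_ofReal]

theorem star_signChange_mul (U : Set (Omega Z)) (f g : (oddTRO Z).carrier) :
    star (signChange U f) * signChange U g = zeroAtInftyToLp (Omega Z) (star f.1 * g.1) := by
  ext x
  have h : (antipodalSign U x : ℂ) * antipodalSign U x = 1 := by
    exact_mod_cast antipodalSign_mul_self U x
  rw [lp.infty_coeFn_mul]
  change star ((antipodalSign U x : ℂ) * f.1 x) * (antipodalSign U x * g.1 x)
    = star (f.1 x) * g.1 x
  rw [star_mul', Complex.star_def, Complex.conj_ofReal]
  linear_combination (starRingEnd ℂ) (f.1 x) * g.1 x * h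

theorem isTernaryMorphism_signChange (U : Set (Omega Z)) :
    IsTernaryMorphism (oddTRO Z) (signChange U) := by
  intro f g k
  rw [mul_assoc, star_signChange_mul]
  ext x
  rw [lp.infty_coeFn_mul]
  change (antipodalSign U x : ℂ) * (f.1 x * star (g.1 x) * k.1 x)
    = antipodalSign U x * f.1 x * (star (g.1 x) * k.1 x)
  ring

theorem isCompletelyIsometric_signChange (U : Set (Omega Z)) :
    IsCompletelyIsometric (oddTRO Z) (signChange U) := by
  refine isCompletelyIsometric_of_star_mul _ _ (zeroAtInftyToLp (Omega Z)) (fun f g h => ?_)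
    (star_signChange_mul U)
  ext x
  exact congrFun (congrArg (fun a : lp (fun _ : Omega Z => ℂ) ∞ => (a : Omega Z → ℂ)) h) x

theorem coneOf_eq_pullback {U : Set (Omega Z)} (hU : IsAntisymmetric U) :
    coneOf U = {f | IsPositiveElement (signChange U f)} := by
  classical
  ext f
  rw [Set.mem_ofPred_eq, isPositiveElement_lp_iff]
  simp only [signChange_apply]
  have hpos : ∀ x, x ∉ -U → (antipodalSign U x : ℂ) * f.1 x = f.1 x := fun x hx => by
    rw [antipodalSign, if_neg hx]
    simp
  have hneg : ∀ x, x ∈ -U → (antipodalSign U x : ℂ) * f.1 x = f.1 (-x) := fun x hx => by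
    rw [antipodalSign, if_pos hx, apply_neg_oddTRO]
    simp
  constructor
  · rintro ⟨h1, h2⟩ x
    by_cases hx : x ∈ -U
    · rw [hneg x hx]
      exact h1 _ hx
    · rw [hpos x hx]
      by_cases hx' : x ∈ U
      · exact h1 x hx'
      · rw [h2 x (by rintro (h | h); exacts [hx' h, hx h])]
  · intro h
    refine ⟨fun x hx => ?_, fun x hx => ?_⟩
    · rw [← hpos x (hU.notMem_neg hx)]
      exact h x
    · have h1 := h x
      have h2 := h (-x)
      rw [hpos x fun h => hx (Or.inr h)] at h1
      rw [hpos (-x) fun h => hx (Or.inl (by simpa using h)), apply_neg_oddTRO, neg_nonneg] at h2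
      exact le_antisymm h2 h1

theorem isNaturalCone_coneOf {U : Set (Omega Z)} (hU : IsAntisymmetric U) :
    IsNaturalCone (oddTRO Z) (coneOf U) := by
  rw [coneOf_eq_pullback hU]
  exact isNaturalCone_of_isometry _ _ (isStarLinear_signChange U) (isTernaryMorphism_signChange U)
    (isCompletelyIsometric_signChange U).norm_map

theorem isOrderedOperatorSpaceCone_coneOf {U : Set (Omega Z)} (hU : IsAntisymmetric U) :
    IsOrderedOperatorSpaceCone (oddTRO Z) (coneOf U) :=
  ⟨_, inferInstance, signChange U, isStarLinear_signChange U, isCompletelyIsometric_signChange U,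
    coneOf_eq_pullback hU⟩

end SignChange

/-! ### Cones are contained in cones of antisymmetric open sets -/

section Containment

variable {Z : Type u} [NormedAddCommGroup Z] [NormedSpace ℂ Z] [StarAddMonoid Z]

theorem oddTRO_norm_apply_le (f : (oddTRO Z).carrier) (x : Omega Z) : ‖f.1 x‖ ≤ ‖f‖ :=
  f.1.toBCF.norm_coe_le_norm x

theorem oddTRO_norm_le {f : (oddTRO Z).carrier} {r : ℝ} (hr : 0 ≤ r) (h : ∀ x, ‖f.1 x‖ ≤ r) :
    ‖f‖ ≤ r :=
  (BoundedContinuousFunction.norm_le (f := f.1.toBCF) hr).2 h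

theorem im_apply_eq_zero_of_isPositiveElement {B : Type u} [NonUnitalCStarAlgebra B]
    {T : (oddTRO Z).carrier →ₗ[ℂ] B} (hs : IsStarLinear (oddTRO Z) T)
    (hi : Function.Injective T) {f : (oddTRO Z).carrier} (hf : IsPositiveElement (T f))
    (x : Omega Z) : (f.1 x).im = 0 := by
  have h : (oddTRO Z).adj f = f := hi (by rw [hs, hf.isSelfAdjoint.star_eq])
  exact Complex.conj_eq_iff_im.1
    (congrArg (fun g : (oddTRO Z).carrier => g.1 x) h : star (f.1 x) = f.1 x)

theorem adj_oddBump (η : C(Omega Z, ℝ)) (hη : HasCompactSupport η) (G : C(Omega Z, ℝ))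
    (hG : ∀ x, G (-x) = G x) :
    (oddTRO Z).adj (oddBump η hη G hG) = oddBump η hη G hG := by
  apply Subtype.ext
  ext x
  exact Complex.conj_ofReal _

/-- If `f` and `g` are in a natural cone and have strictly opposite signs near a point, then for
suitable odd bump functions `k`, `l` the elements `k² f = -l² g` are mapped to positive elements,
so they vanish. -/
theorem IsNaturalCone.exists_subset_coneOf [LocallyCompactSpace (Omega Z)]
    {𝔠 : Set (oddTRO Z).carrier} (h : IsNaturalCone (oddTRO Z) 𝔠) :
    ∃ U : Set (Omega Z), IsOpen U ∧ IsAntisymmetric U ∧ 𝔠 ⊆ coneOf U := by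
  obtain ⟨B, _, Y, T, hs, ht, hi, -, rfl⟩ := h
  have him : ∀ f, IsPositiveElement (T f) → ∀ y, (f.1 y).im = 0 := fun f hf y =>
    im_apply_eq_zero_of_isPositiveElement hs hi hf y
  refine _root_.exists_subset_coneOf him fun f hf g hg x hfx => ?_
  by_contra! hgx
  let V : Set (Omega Z) := {y | 0 < (f.1 y).re ∧ (g.1 y).re < 0}
  have hV : IsOpen V :=
    (isOpen_lt continuous_const (Complex.continuous_re.comp f.1.continuous)).inter
      (isOpen_lt (Complex.continuous_re.comp g.1.continuous) continuous_const)
  have hVneg : ∀ y ∈ V, -y ∉ V := fun y hy hy' => by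
    have h1 := hy'.1
    rw [apply_neg_oddTRO, Complex.neg_re] at h1
    linarith [hy.1]
  obtain ⟨η, hη, hηx, -, hη0⟩ := exists_bump hV (x := x) ⟨hfx, hgx⟩
  let R : (oddTRO Z).carrier → C(Omega Z, ℝ) := fun f =>
    ⟨fun y => Real.sqrt |(f.1 y).re|,
      (Complex.continuous_re.comp f.1.continuous).abs.sqrt⟩
  have hR : ∀ f y, R f (-y) = R f y := fun f y => by
    change Real.sqrt |(f.1 (-y)).re| = Real.sqrt |(f.1 y).re|
    rw [apply_neg_oddTRO, Complex.neg_re, abs_neg]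
  let k := oddBump η hη (R g) (hR g)
  let l := oddBump η hη (R f) (hR f)
  have hpos : ∀ (m q : (oddTRO Z).carrier), (oddTRO Z).adj m = m → IsPositiveElement (T q) →
      IsPositiveElement (T ((oddTRO Z).triple m q m)) := by
    intro m q hm hq
    have hqs := hq.isSelfAdjoint.star_eq
    obtain ⟨b, hb⟩ := hq
    have hms : star (T m) = T m := by rw [← hs, hm]
    refine ⟨b * T m, ?_⟩
    rw [ht, hqs, star_mul, hms, hb]
    simp only [mul_assoc]
  have hsq : ∀ (f g : (oddTRO Z).carrier) (y : Omega Z), (f.1 y).im = 0 →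
      ((oddTRO Z).triple (oddBump η hη (R g) (hR g)) f (oddBump η hη (R g) (hR g))).1 y
        = (((η y - η (-y)) ^ 2 * (|(g.1 y).re| * (f.1 y).re) : ℝ) : ℂ) := by
    intro f g y hy
    have hfy : f.1 y = ((f.1 y).re : ℂ) := Complex.ext rfl hy
    change (((η y - η (-y)) * Real.sqrt |(g.1 y).re| : ℝ) : ℂ) * star (f.1 y)
      * (((η y - η (-y)) * Real.sqrt |(g.1 y).re| : ℝ) : ℂ) = _
    have h1 : |(g.1 y).re| = Real.sqrt |(g.1 y).re| * Real.sqrt |(g.1 y).re| :=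
      (Real.mul_self_sqrt (abs_nonneg _)).symm
    rw [Complex.star_def, Complex.conj_eq_iff_im.2 hy, hfy, Complex.ofReal_re]
    conv_rhs => rw [h1]
    push_cast
    ring
  have heq : (oddTRO Z).triple k f k = -(oddTRO Z).triple l g l := by
    apply Subtype.ext
    ext y
    change ((oddTRO Z).triple k f k).1 y = -((oddTRO Z).triple l g l).1 y
    rw [hsq f g y (him f hf y), hsq g f y (him g hg y), ← Complex.ofReal_neg]
    congr 1
    by_cases hy : y ∈ V
    · rw [abs_of_neg hy.2, abs_of_pos hy.1]
      ring
    by_cases hy' : -y ∈ V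
    · have h1 := hy'.1
      have h2 := hy'.2
      rw [apply_neg_oddTRO, Complex.neg_re] at h1 h2
      rw [abs_of_pos (by linarith : 0 < (g.1 y).re), abs_of_neg (by linarith : (f.1 y).re < 0)]
      ring
    · rw [hη0 y hy, hη0 _ hy']
      ring
  have h0 : T ((oddTRO Z).triple k f k) = 0 := by
    refine (hpos k f (adj_oddBump _ _ _ _) hf).eq_zero_of_neg ?_
    rw [heq, map_neg, neg_neg]
    exact hpos l g (adj_oddBump _ _ _ _) hg
  have h1 : (oddTRO Z).triple k f k = 0 := hi (h0.trans (map_zero T).symm)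
  have h2 := hsq f g x (him f hf x)
  have h3 : ((oddTRO Z).triple k f k).1 x = 0 := by
    rw [h1]
    rfl
  rw [h3, hηx, hη0 (-x) (hVneg x ⟨hfx, hgx⟩)] at h2
  have h4 : (0 : ℝ) < (1 - 0) ^ 2 * (|(g.1 x).re| * (f.1 x).re) := by
    have := abs_pos.2 hgx.ne
    positivity
  exact h4.ne (Complex.ofReal_injective (by rw [← h2]; rfl))

/-- An odd bump of height `r + α` supported in `V ∪ -V` stays at distance at most `r` from every
real odd function of norm at most `r` that is larger than `α` on `V`. -/
theorem norm_oddBump_sub_le {V : Set (Omega Z)} (hVneg : ∀ y ∈ V, -y ∉ V) {η : C(Omega Z, ℝ)}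
    (hη : HasCompactSupport η) (hη01 : ∀ y, 0 ≤ η y ∧ η y ≤ 1) (hη0 : ∀ y, y ∉ V → η y = 0)
    {α r : ℝ} (hα : 0 < α) (hr : 0 ≤ r) {q : (oddTRO Z).carrier} (hq : ∀ y, (q.1 y).im = 0)
    (hqr : ‖q‖ ≤ r) (hqV : ∀ y ∈ V, α < (q.1 y).re) :
    ‖oddBump η hη (ContinuousMap.const _ (r + α)) (fun _ => rfl) - q‖ ≤ r := by
  set u := oddBump η hη (ContinuousMap.const _ (r + α)) fun _ => rfl
  have hu : ∀ y, u.1 y = (((η y - η (-y)) * (r + α) : ℝ) : ℂ) := fun y => rfl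
  have hsub : ∀ y, (u - q).1 y = u.1 y - q.1 y := fun y => rfl
  clear_value u
  have hin : ∀ y ∈ V, ‖(u - q).1 y‖ ≤ r := by
    intro y hy
    have h1 : (u - q).1 y = ((η y * (r + α) - (q.1 y).re : ℝ) : ℂ) := by
      rw [hsub, hu, hη0 (-y) (hVneg y hy), sub_zero, Complex.ofReal_sub]
      congr 1
      exact Complex.ext rfl (hq y)
    have h2 := abs_le.1 ((Complex.abs_re_le_norm _).trans ((oddTRO_norm_apply_le q y).trans hqr))
    have h3 := hqV y hy
    have h4 := hη01 y
    have h5 : 0 ≤ r + α := by positivity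
    rw [h1, Complex.norm_real, Real.norm_eq_abs, abs_le]
    constructor
    · linarith [mul_nonneg h4.1 h5]
    · linarith [mul_le_of_le_one_left h5 h4.2]
  refine oddTRO_norm_le hr fun y => ?_
  by_cases hy : y ∈ V
  · exact hin y hy
  by_cases hy' : -y ∈ V
  · have h1 := hin _ hy'
    rwa [apply_neg_oddTRO, norm_neg] at h1
  · rw [hsub, hu, hη0 y hy, hη0 _ hy', sub_zero, zero_mul, Complex.ofReal_zero, zero_sub, norm_neg]
    exact (oddTRO_norm_apply_le q y).trans hqr

/-- If `f` and `g` are in an ordered operator space cone, with `f > α` and `g < -α` near a point,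
let `u` be an odd bump there of height `‖f‖ + ‖g‖ + α`. Then `u - f` and `u + g` have norm at most
`‖f‖ + ‖g‖ < ‖u‖`, which contradicts `norm_le_of_isPositiveElement`. -/
theorem IsOrderedOperatorSpaceCone.exists_subset_coneOf [LocallyCompactSpace (Omega Z)]
    {𝔠 : Set (oddTRO Z).carrier} (h : IsOrderedOperatorSpaceCone (oddTRO Z) 𝔠) :
    ∃ U : Set (Omega Z), IsOpen U ∧ IsAntisymmetric U ∧ 𝔠 ⊆ coneOf U := by
  obtain ⟨B, _, T, hs, hci, rfl⟩ := h
  have hi : Function.Injective T :=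
    (AddMonoidHomClass.isometry_of_norm T hci.norm_map).injective
  have him : ∀ f, IsPositiveElement (T f) → ∀ y, (f.1 y).im = 0 := fun f hf y =>
    im_apply_eq_zero_of_isPositiveElement hs hi hf y
  refine _root_.exists_subset_coneOf him fun f hf g hg x hfx => ?_
  by_contra! hgx
  obtain ⟨α, hα, hαf, hαg⟩ : ∃ α : ℝ, 0 < α ∧ α < (f.1 x).re ∧ α < -(g.1 x).re := by
    obtain ⟨α, h0, h1⟩ := exists_between (lt_min hfx (neg_pos.2 hgx))
    exact ⟨α, h0, lt_min_iff.1 h1⟩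
  let V : Set (Omega Z) := {y | α < (f.1 y).re ∧ α < -(g.1 y).re}
  have hV : IsOpen V :=
    (isOpen_lt continuous_const (Complex.continuous_re.comp f.1.continuous)).inter
      (isOpen_lt continuous_const (Complex.continuous_re.comp g.1.continuous).neg)
  have hVneg : ∀ y ∈ V, -y ∉ V := fun y hy hy' => by
    have h1 := hy'.1
    rw [apply_neg_oddTRO, Complex.neg_re] at h1
    linarith [hy.1]
  obtain ⟨η, hη, hηx, hη01, hη0⟩ := exists_bump hV (x := x) ⟨hαf, hαg⟩
  have hr : 0 ≤ ‖f‖ + ‖g‖ := by positivity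
  set u := oddBump η hη (ContinuousMap.const _ (‖f‖ + ‖g‖ + α)) fun _ => rfl
  have hu : ∀ y, u.1 y = (((η y - η (-y)) * (‖f‖ + ‖g‖ + α) : ℝ) : ℂ) := fun y => rfl
  have hadj : (oddTRO Z).adj u = u := adj_oddBump _ _ _ _
  have h1 : ‖u - f‖ ≤ ‖f‖ + ‖g‖ :=
    norm_oddBump_sub_le hVneg hη hη01 hη0 hα hr (him f hf)
      (le_add_of_nonneg_right (norm_nonneg _)) fun y hy => hy.1
  have h2 : ‖u - -g‖ ≤ ‖f‖ + ‖g‖ := by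
    refine norm_oddBump_sub_le hVneg hη hη01 hη0 hα hr (fun y => ?_) ?_ fun y hy => ?_
    · change (-(g.1 y)).im = 0
      rw [Complex.neg_im, him g hg y, neg_zero]
    · rw [norm_neg]
      exact le_add_of_nonneg_left (norm_nonneg _)
    · change α < (-(g.1 y)).re
      rw [Complex.neg_re]
      exact hy.2
  clear_value u
  have h3 : ‖T u‖ ≤ ‖f‖ + ‖g‖ := by
    refine norm_le_of_isPositiveElement hf ?_ hg ?_ ?_
    · rw [IsSelfAdjoint, ← hs, hadj]
    · rw [← map_sub, hci.norm_map]
      exact h1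
    · rw [← map_add, hci.norm_map, ← sub_neg_eq_add]
      exact h2
  rw [hci.norm_map] at h3
  have h4 := (oddTRO_norm_apply_le u x).trans h3
  rw [hu, hηx, hη0 _ (hVneg x ⟨hαf, hαg⟩), Complex.norm_real, sub_zero, one_mul,
    Real.norm_of_nonneg (by positivity)] at h4
  linarith

end Containment

/-! ### Maximal cones and antipodal colorings -/

section Maximal

variable {Z : Type u} [NormedAddCommGroup Z] [NormedSpace ℂ Z] [StarAddMonoid Z]
  [LocallyCompactSpace (Omega Z)]

theorem isMaximalNaturalCone_coneOf_iff {U : Set (Omega Z)} (hU : IsOpen U)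
    (hd : IsAntisymmetric U) : IsMaximalNaturalCone (oddTRO Z) (coneOf U) ↔
      ¬ ∃ U' : Set (Omega Z), IsOpen U' ∧ IsAntisymmetric U' ∧ U ⊂ U' := by
  constructor
  · rintro h ⟨U', hU', hd', hsub⟩
    exact hsub.2 ((coneOf_subset_coneOf_iff hU' hd' hd).1
      (h.2 (isNaturalCone_coneOf hd') ((coneOf_subset_coneOf_iff hU hd hd').2 hsub.1)))
  · refine fun h => ⟨isNaturalCone_coneOf hd, fun 𝔡 h𝔡 hle => ?_⟩
    obtain ⟨U', hU', hd', hsub⟩ := h𝔡.exists_subset_coneOf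
    have h1 : U ⊆ U' := (coneOf_subset_coneOf_iff hU hd hd').1 (hle.trans hsub)
    have h2 : U = U' := by
      by_contra hne
      exact h ⟨U', hU', hd', Set.ssubset_iff_subset_ne.2 ⟨h1, hne⟩⟩
    exact h2 ▸ hsub

theorem isMaximalCone_coneOf_iff {U : Set (Omega Z)} (hU : IsOpen U)
    (hd : IsAntisymmetric U) : IsMaximalCone (oddTRO Z) (coneOf U) ↔
      ¬ ∃ U' : Set (Omega Z), IsOpen U' ∧ IsAntisymmetric U' ∧ U ⊂ U' := by
  constructor
  · rintro h ⟨U', hU', hd', hsub⟩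
    exact hsub.2 ((coneOf_subset_coneOf_iff hU' hd' hd).1 (h.2
      (isOrderedOperatorSpaceCone_coneOf hd') ((coneOf_subset_coneOf_iff hU hd hd').2 hsub.1)))
  · refine fun h => ⟨isOrderedOperatorSpaceCone_coneOf hd, fun 𝔡 h𝔡 hle => ?_⟩
    obtain ⟨U', hU', hd', hsub⟩ := h𝔡.exists_subset_coneOf
    have h1 : U ⊆ U' := (coneOf_subset_coneOf_iff hU hd hd').1 (hle.trans hsub)
    have h2 : U = U' := by
      by_contra hne
      exact h ⟨U', hU', hd', Set.ssubset_iff_subset_ne.2 ⟨h1, hne⟩⟩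
    exact h2 ▸ hsub

theorem IsMaximalCone.exists_eq_coneOf {𝔠 : Set (oddTRO Z).carrier}
    (h : IsMaximalCone (oddTRO Z) 𝔠) : ∃ U : Set (Omega Z), IsOpen U ∧ IsAntisymmetric U ∧
      𝔠 = coneOf U := by
  obtain ⟨U, hU, hd, hsub⟩ := h.1.exists_subset_coneOf
  exact ⟨U, hU, hd, hsub.antisymm (h.2 (isOrderedOperatorSpaceCone_coneOf hd) hsub)⟩

end Maximal

end

theorem corollary6p10 {Z : Type u} [NormedAddCommGroup Z] [NormedSpace ℂ Z] [StarAddMonoid Z]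
    [StarModule ℂ Z] [Nontrivial Z] (p : Z → Z → Z → Z)
    (hZ : IsCommInvolutiveTernarySystem Z p) :
    -- `Ω` is locally compact, and `Z ≅ W ⊆ C₀(Ω)` via evaluation
    LocallyCompactSpace (Omega Z) ∧
    (∃ Φ : Z ≃ₗᵢ[ℂ] (oddTRO Z).carrier,
      (∀ (z : Z) (ψ : Omega Z), (Φ z).1 ψ = ψ.1 z) ∧
      (∀ z, Φ (star z) = (oddTRO Z).adj (Φ z)) ∧
      ∀ x y z, Φ (p x y z) = (oddTRO Z).triple (Φ x) (Φ y) (Φ z)) ∧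
    -- the equivalences
    (∀ U : Set (Omega Z), IsOpen U → IsAntisymmetric U →
      List.TFAE
        [IsMaximalNaturalCone (oddTRO Z) (coneOf U),
         (U ∪ -U)ᶜ = frontier U,
         (U ∪ -U)ᶜ = frontier (-U),
         frontier U = frontier (-U) ∧ interior (U ∪ -U)ᶜ = ∅,
         ¬ ∃ U' : Set (Omega Z), IsOpen U' ∧ IsAntisymmetric U' ∧ U ⊂ U']) ∧
    -- in this case `𝔠_U` consists of all functions in `W` which are nonnegative on `U`
    (∀ U : Set (Omega Z), IsOpen U → IsAntisymmetric U →
      IsMaximalNaturalCone (oddTRO Z) (coneOf U) →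
      coneOf U = {f : (oddTRO Z).carrier | ∀ x ∈ U, 0 ≤ f.1 x}) ∧
    -- every maximal cone is of this form
    (∀ 𝔠 : Set (oddTRO Z).carrier, IsMaximalCone (oddTRO Z) 𝔠 →
      ∃ U : Set (Omega Z), IsOpen U ∧ IsAntisymmetric U ∧ 𝔠 = coneOf U ∧
        IsMaximalNaturalCone (oddTRO Z) (coneOf U)) ∧
    -- maximal cones correspond bijectively to antipodal colorings
    Set.BijOn coneOf {U : Set (Omega Z) | IsAntipodalColoring U}
      {𝔠 : Set (oddTRO Z).carrier | IsMaximalCone (oddTRO Z) 𝔠} := by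
  obtain ⟨K, _, _, T, hT⟩ := hZ.exists_isFunctionModel
  have : CompleteSpace Z := hZ.completeSpace
  have : LocallyCompactSpace (Omega Z) := hT.locallyCompactSpace_Omega
  have hne : ∀ ψ : Omega Z, ψ ≠ -ψ := fun ψ h => by
    refine hT.ne_zero_of_mem_Omega ψ.2 (DFunLike.ext _ _ fun z => ?_)
    exact self_eq_neg.1 (congrArg (fun χ : Omega Z => χ.1 z) h : ψ.1 z = -(ψ.1 z))
  have hmax : ∀ U : Set (Omega Z), IsOpen U → IsAntisymmetric U →
      ((U ∪ -U)ᶜ = frontier U ↔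
        ¬ ∃ U' : Set (Omega Z), IsOpen U' ∧ IsAntisymmetric U' ∧ U ⊂ U') :=
    fun U hU hd => compl_eq_frontier_iff_maximal hne hU hd
  refine ⟨inferInstance, ⟨LinearIsometryEquiv.ofSurjective hT.evalIsometry
    hT.evalIsometry_surjective, fun z ψ => rfl, fun z => ?_, fun x y z => ?_⟩,
    fun U hU hd => ?_, fun U hU hd h => ?_, fun 𝔠 h => ?_, ?_, ?_, ?_⟩
  · apply Subtype.ext
    ext ψ
    exact ψ.2.1.2 z
  · apply Subtype.ext
    ext ψ
    exact (hT.mem_Omega_iff.1 ψ.2).1.2 x y z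
  · tfae_have 1 ↔ 5 := isMaximalNaturalCone_coneOf_iff hU hd
    tfae_have 2 ↔ 5 := hmax U hU hd
    tfae_have 3 ↔ 2 := compl_eq_frontier_neg_iff
    tfae_have 2 ↔ 4 := compl_eq_frontier_iff hU hd
    tfae_finish
  · exact coneOf_eq_of_compl_eq_frontier
      ((hmax U hU hd).2 ((isMaximalNaturalCone_coneOf_iff hU hd).1 h))
  · obtain ⟨U, hU, hd, rfl⟩ := h.exists_eq_coneOf
    exact ⟨U, hU, hd, rfl, (isMaximalNaturalCone_coneOf_iff hU hd).2
      ((isMaximalCone_coneOf_iff hU hd).1 h)⟩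
  · rintro U ⟨hU, hd, hfr⟩
    exact (isMaximalCone_coneOf_iff hU hd).2 ((hmax U hU hd).1 hfr)
  · rintro U ⟨hU, hd, -⟩ U' ⟨hU', hd', -⟩ h
    exact ((coneOf_subset_coneOf_iff hU hd hd').1 h.subset).antisymm
      ((coneOf_subset_coneOf_iff hU' hd' hd).1 h.symm.subset)
  · intro 𝔠 h
    obtain ⟨U, hU, hd, rfl⟩ := IsMaximalCone.exists_eq_coneOf h
    exact ⟨U, ⟨hU, hd, (hmax U hU hd).2 ((isMaximalCone_coneOf_iff hU hd).1 h)⟩, rfl⟩
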